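/- Let $p\in(0,1)$. A single-server first-in first-out queue has i.i.d. nonnegative interarrival times $t_1,t_2,\dots$ with finite mean $a>0$ and i.i.d. nonnegative service times distributed as $\sigma$, with finite mean $b$; each customer finishing a service returns to the end of the queue with probability $p$ and otherwise leaves. Put $\lambda=1/a$, $r=p+\lambda b$, and assume stability: $\lambda b/(1-p)<1$. Put $$m^{(0)}_k=\frac{1-r^k}{1-r}\,\lambda b\qquad(k\ge 0).$$ Call a distribution with tail $\overline F$ intermediate regularly varying (IRV) if $\overline F(x)>0$ for all $x$ and $\lim_{\alpha\downarrow1}\liminf_{x\to\infty}\overline F(\alpha x)/\overline F(x)=1$. A tagged customer arrives at time $0$ at the empty system, and its first service time is $\eta\ge0$ instead of an ordinary one. Let $N^e(s)=\#\{n\ge1:\ t_1+\dots+t_n\le s\}$. For $k\ge 1$, $i\ge 0$ let $\sigma_{k,i}$ be copies of $\sigma$, and for $k,i\ge 1$ let $\beta_{k,i}$ be Bernoulli($p$) variables, where all of $(t_n)$, $(\sigma_{k,i})$, $(\beta_{k,i})$, $\eta$ are mutually independent. Define $X^{(0)}_0=0$, $T_0=0$, and for $k\ge1$ $$U_1=\eta,\qquad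 U_k=\sum_{i=0}^{X^{(0)}_{k-1}}\sigma_{k,i}\ (k\ge2),\qquad T_k=T_{k-1}+U_k,$$ $$X^{(0)}_k=N^e(T_k)-N^e(T_{k-1})+\sum_{i=1}^{X^{(0)}_{k-1}}\beta_{k,i},$$ so that $T_k$ is the time of the $k$-th service completion of the tagged customer and $X^{(0)}_k$ is the queue length behind it at that time. **Theorem.** Assume that the distribution of $\sigma$ is IRV and that (I) $\eta$ has an IRV distribution with $\mathbb E\,\eta<\infty$; (II) $\mathbb P(\eta>x)/\mathbb P(\sigma>x)$ converges to a limit in $[0,\infty]$ as $x\to\infty$; (III) $\mathbb E\,X^{(0)}_{k-1}<\infty$ for all $k\ge1$. Then, for each $k\ge1$, as $x\to\infty$, $$\mathbb P(T_k>x)\sim\sum_{\ell=0}^{k-2}\mathbb E\bigl(1+X^{(0)}_{k-\ell-1}\bigr)\,\mathbb P\bigl((1+m^{(0)}_\ell)\sigma>x\bigr)+\mathbb P\bigl((1+m^{(0)}_{k-1})\eta>x\bigr),$$ where the sum is empty for $k=1$, and $f\sim g$ means $f(x)/g(x)\to1$. -/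

import Mathlib

open Filter Topology MeasureTheory ProbabilityTheory Asymptotics
open scoped ENNReal

noncomputable section

/-- The tail `P(Y > x)` of a random variable `Y` with law `F`. -/
def tail (F : Measure ℝ) (x : ℝ) : ℝ := F.real (Set.Ioi x)

/-- A distribution on the real line is intermediate regularly varying if its tail is everywhere
positive and `lim_{α ↓ 1} liminf_{x → ∞} tail (α x) / tail x = 1`.  For `α > 1` and `x > 0` the
ratio lies in `[0, 1]`, so that the real-valued `liminf` is the genuine one. -/
structure IsIRV (F : Measure ℝ) : Prop where
  tail_pos : ∀ x, 0 < tail F x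
  tendsto_liminf :
    Tendsto (fun α : ℝ => liminf (fun x : ℝ => tail F (α * x) / tail F x) atTop) (𝓝[>] 1) (𝓝 1)

/-- A probability law of a nonnegative random variable with finite mean. -/
structure IsNonnegLawWithMean (F : Measure ℝ) : Prop where
  isProb : IsProbabilityMeasure F
  nonneg : ∀ᵐ s ∂F, 0 ≤ s
  integrable : Integrable (fun s : ℝ => s) F

/-- The mean of a law. -/
def mean (F : Measure ℝ) : ℝ := ∫ s, s ∂F

/-- The primitive random variables that drive the single-server feedback queue seen by a tagged
customer, who arrives at time `0` and finds the system empty. -/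
structure FeedbackInput (Ω : Type*) where
  /-- `interarrival n` is the time between the `n`-th and the `(n+1)`-st exogenous arrival after
  the tagged customer (the tagged customer itself being the `0`-th). -/
  interarrival : ℕ → Ω → ℝ
  /-- `service k 0` is the `k`-th service time of the tagged customer (used for `k ≥ 2`);
  `service k i`, `i ≥ 1`, is the time of the `i`-th service among the customers standing before
  the tagged one while it waits for its `k`-th service. -/
  service : ℕ → ℕ → Ω → ℝ
  /-- `returns k i`, `i ≥ 1`: the customer with service time `service k i` rejoins the queue after
  that service. -/
  returns : ℕ → ℕ → Ω → Bool
  /-- The exceptional first service time `η` of the tagged customer. -/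
  first : Ω → ℝ

/-- Labels of the primitive random variables. -/
inductive Source : Type
  | interarrival (n : ℕ)
  | service (k i : ℕ)
  | returns (k i : ℕ)
  | first

namespace FeedbackInput

variable {Ω : Type*}

/-- All primitive random variables as one real-valued family (a return is coded by `1`, a departure
by `0`). -/
def var (Q : FeedbackInput Ω) : Source → Ω → ℝ
  | .interarrival n => Q.interarrival n
  | .service k i => Q.service k i
  | .returns k i => fun ω => if Q.returns k i ω then 1 else 0
  | .first => Q.first

/-- `Q.arrivals s` is `N^e(s)`, the number of exogenous arrivals after the tagged customer up to
time `s`: the number of `n ≥ 1` such that the sum of the first `n` interarrival times is at most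
`s`.  (This number is almost surely finite when the mean interarrival time is positive.) -/
def arrivals (Q : FeedbackInput Ω) (s : ℝ) (ω : Ω) : ℕ :=
  Set.ncard {n : ℕ | 1 ≤ n ∧ ∑ j ∈ Finset.range n, Q.interarrival j ω ≤ s}

/-- The time `U_k` from the `(k-1)`-st to the `k`-th service completion of the tagged customer
(`k ≥ 1`) if `x = X_{k-1}` customers stood behind it at the former epoch. -/
def stage (Q : FeedbackInput Ω) (k x : ℕ) (ω : Ω) : ℝ :=
  if k = 1 then Q.first ω else ∑ i ∈ Finset.range (x + 1), Q.service k i ω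

/-- The number `N^B_k(x)` of those among `x` customers served during the `k`-th stage that return. -/
def numReturns (Q : FeedbackInput Ω) (k x : ℕ) (ω : Ω) : ℕ :=
  ∑ i ∈ Finset.Icc 1 x, if Q.returns k i ω then 1 else 0

/-- The pair `(X_k, T_k)` for a tagged customer that finds the system empty: `X_0 = 0`, `T_0 = 0`,
`T_k = T_{k-1} + U_k` and `X_k = N^e(T_k) - N^e(T_{k-1}) + N^B_k(X_{k-1})`. -/
def state (Q : FeedbackInput Ω) : ℕ → Ω → ℕ × ℝ
  | 0, _ => (0, 0)
  | k + 1, ω =>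
    let x := (state Q k ω).1
    let t := (state Q k ω).2
    let t' := t + Q.stage (k + 1) x ω
    (Q.arrivals t' ω - Q.arrivals t ω + Q.numReturns (k + 1) x ω, t')

/-- `X_k`: the queue length behind the tagged customer when it finishes its `k`-th service. -/
def X (Q : FeedbackInput Ω) (k : ℕ) (ω : Ω) : ℕ := (Q.state k ω).1

/-- `T_k`: the time at which the tagged customer finishes its `k`-th service. -/
def T (Q : FeedbackInput Ω) (k : ℕ) (ω : Ω) : ℝ := (Q.state k ω).2

/-- The primitive random variables are those of a `GI/GI/1` feedback queue with interarrival law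
`A`, service law `G`, return probability `p` and exceptional first service law `H`. -/
structure IsGIGI1 [MeasurableSpace Ω] (Q : FeedbackInput Ω) (P : Measure Ω)
    (A G H : Measure ℝ) (p : ℝ) : Prop where
  measurable_var : ∀ s, Measurable (Q.var s)
  indep : iIndepFun Q.var P
  law_interarrival : ∀ n, P.map (Q.interarrival n) = A
  law_service : ∀ k i, P.map (Q.service k i) = G
  law_returns : ∀ k i, P.real {ω | Q.returns k i ω = true} = p
  law_first : P.map Q.first = H

end FeedbackInput

/-- `m_k = (1 - r^k) / (1 - r) * λ b` with `r = p + λ b`, where `rate` stands for `λ`. -/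
def meanQueue (rate b p : ℝ) (k : ℕ) : ℝ :=
  (1 - (p + rate * b) ^ k) / (1 - (p + rate * b)) * (rate * b)

end

/-! The proof is the principle of one big jump: `T_k` exceeds a large `x` essentially only because a
single service time is large. Suppose a stage lasts a long time `Y`. By the law of large numbers
about `λY` customers arrive during it, so the next stage lasts about `λbY`. From then on each stage
multiplies the queue by `r = p + λb`, through returns and new arrivals. After `ℓ` further stages the
elapsed time is about `(1 + λb(1 + r + ... + r^(ℓ-1)))Y = (1 + m_ℓ)Y`. The jump is either `η` or one
of the `1 + X_j` services of the stage `j + 1`, and averaging over their number gives the weights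
`E(1 + X_j)`. Intermediate regular variation makes every relative error `1 ± ε` in the size of the
jump harmless.

Upper bound. The functional `T_k + βX_k` is followed backwards in `k`. Up to events of exponentially
small probability (`exists_shifted_lower_deviation_bound`, `IsGIGI1.exists_returns_bound`) it is at
most a linear function of `T_{k-1}`, `X_{k-1}` and the stage length, plus a small multiple of `x`.
The stage length is a sum of `1 + X_{k-1}` services independent of the past.
`eventually_random_sum_tail_le` shows that either one summand is the jump or the sum may be replaced
by its mean, which turns `β` into `b + rβ`. Starting from `β = 0`, the iterates multiplied by `λ`
are exactly the `m_ℓ`. The random sum lemma rests on `exists_large_deviation_bound`: its linear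
dependence on the number of summands lets `E X_k < ∞` supply a dominating series.

Lower bound. For each possible jump there is an event, independent of that service time, on which
the other variables obey their laws of large numbers and the jump does contribute
(`IsGIGI1.exists_good_event`). There the deterministic estimate `exists_state_error_bound` forces
`T_k > x`. Two jumps at once have negligible probability, so the contributions add up
(`sum_le_measureReal_biUnion`). -/

section Tail

/-! ### Intermediate regularly varying tails. -/

variable {F : Measure ℝ}

lemma tail_nonneg (F : Measure ℝ) (x : ℝ) : 0 ≤ tail F x := measureReal_nonneg

lemma tail_le_one [IsProbabilityMeasure F] (x : ℝ) : tail F x ≤ 1 := measureReal_le_one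

lemma tail_antitone [IsProbabilityMeasure F] : Antitone (tail F) := fun _ _ h =>
  measureReal_mono (Set.Ioi_subset_Ioi h)

lemma tail_tendsto_zero [IsProbabilityMeasure F] : Tendsto (tail F) atTop (𝓝 0) := by
  have h := tendsto_measure_iInter_atTop (μ := F) (s := fun x : ℝ => Set.Ioi x)
    (fun _ => measurableSet_Ioi.nullMeasurableSet) (fun _ _ h => Set.Ioi_subset_Ioi h)
    ⟨0, measure_ne_top _ _⟩
  have h0 : ⋂ x : ℝ, Set.Ioi x = ∅ := by
    ext y; simp only [Set.mem_iInter, Set.mem_Ioi, Set.mem_empty_iff_false, iff_false, not_forall]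
    exact ⟨y, lt_irrefl y⟩
  rw [h0, measure_empty] at h
  exact (ENNReal.tendsto_toReal ENNReal.zero_ne_top).comp h

lemma real_lt_mul_eq_tail (F : Measure ℝ) {c : ℝ} (hc : 0 < c) (x : ℝ) :
    F.real {s | x < c * s} = tail F (x / c) := by
  have : {s : ℝ | x < c * s} = Set.Ioi (x / c) := by
    ext s; simp [div_lt_iff₀' hc]
  rw [this, tail]

/-- The tail of an intermediate regularly varying law is insensitive to small dilations. -/
lemma IsIRV.eventually_le_tail_mul (hF : IsIRV F) {ε : ℝ} (hε : 0 < ε) :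
    ∃ α > 1, ∀ᶠ x in atTop, (1 - ε) * tail F x ≤ tail F (α * x) := by
  have h1 := hF.tendsto_liminf.eventually (lt_mem_nhds (show 1 - ε < 1 by linarith))
  obtain ⟨α, h2, hα⟩ := (h1.and self_mem_nhdsWithin).exists
  refine ⟨α, hα, ?_⟩
  have hb : IsBoundedUnder (· ≥ ·) atTop (fun x : ℝ => tail F (α * x) / tail F x) :=
    isBoundedUnder_of ⟨0, fun x => div_nonneg (tail_nonneg _ _) (tail_nonneg _ _)⟩
  filter_upwards [eventually_lt_of_lt_liminf h2 hb] with x hx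
  exact ((lt_div_iff₀ (hF.tail_pos x)).1 hx).le

lemma IsIRV.eventually_tail_mul_le (hF : IsIRV F) {ε : ℝ} (hε : 0 < ε) :
    ∃ ρ, 0 < ρ ∧ ρ < 1 ∧ ∀ᶠ x in atTop, tail F (ρ * x) ≤ (1 + ε) * tail F x := by
  -- This value makes `1 - ε / (1 + ε)` the inverse of `1 + ε`; the lower bound is then read at `α⁻¹
  -- * x`.
  obtain ⟨α, hα, h⟩ := hF.eventually_le_tail_mul (ε := ε / (1 + ε)) (by positivity)
  have hα0 : 0 < α := by linarith
  refine ⟨α⁻¹, by positivity, inv_lt_one_of_one_lt₀ hα, ?_⟩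
  filter_upwards [(tendsto_id.const_mul_atTop (inv_pos.2 hα0)).eventually h] with x hx
  have e1 : 1 - ε / (1 + ε) = (1 + ε)⁻¹ := by field_simp; ring
  simp only [id, mul_inv_cancel_left₀ hα0.ne', e1] at hx
  rwa [inv_mul_le_iff₀ (by positivity)] at hx

/-- A global Potter-type bound. -/
lemma IsIRV.potter [IsProbabilityMeasure F] (hF : IsIRV F) :
    ∃ C : ℝ, 1 ≤ C ∧ ∃ K : ℕ, ∀ w t : ℝ, 1 ≤ t → tail F w ≤ C * t ^ K * tail F (t * w) := by
  obtain ⟨α, hα, h⟩ := hF.eventually_le_tail_mul (ε := 1 / 2) (by norm_num)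
  obtain ⟨x₀, hx₀⟩ := eventually_atTop.1 h
  set x₁ := max x₀ 1
  have hx1 : 0 < x₁ := lt_of_lt_of_le one_pos (le_max_right _ _)
  -- Dilating by `α ^ n` costs a factor `2 ^ n`, and `2 < α ^ K` bounds this by `(α ^ n) ^ K ≤ t ^
  -- K`.
  obtain ⟨K, hK⟩ := pow_unbounded_of_one_lt 2 hα
  have hpow : ∀ n : ℕ, ∀ w, x₁ ≤ w → tail F w ≤ 2 ^ n * tail F (α ^ n * w) := by
    intro n
    induction n with
    | zero => intro w _; simp
    | succ n ih =>
      intro w hw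
      have h1 : x₁ ≤ α ^ n * w := hw.trans
        (le_mul_of_one_le_left (hx1.le.trans hw) (one_le_pow₀ hα.le))
      have h2 := hx₀ _ ((le_max_left _ _).trans h1)
      rw [← mul_assoc, ← pow_succ'] at h2
      calc tail F w ≤ 2 ^ n * tail F (α ^ n * w) := ih w hw
        _ ≤ 2 ^ n * (2 * tail F (α ^ (n + 1) * w)) := by gcongr; linarith
        _ = _ := by ring
  have hbig : ∀ w t, x₁ ≤ w → 1 ≤ t → tail F w ≤ 2 * t ^ K * tail F (t * w) := by
    intro w t hw ht
    obtain ⟨n, hn1, hn2⟩ := exists_nat_pow_near ht hα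
    calc tail F w ≤ 2 ^ (n + 1) * tail F (α ^ (n + 1) * w) := hpow _ w hw
      _ ≤ (2 * t ^ K) * tail F (t * w) := by
        refine mul_le_mul ?_ ?_ (tail_nonneg _ _) (by positivity)
        · rw [pow_succ']
          gcongr
          calc (2 : ℝ) ^ n ≤ (α ^ K) ^ n := by gcongr
            _ = (α ^ n) ^ K := by rw [← pow_mul, ← pow_mul, mul_comm]
            _ ≤ t ^ K := by gcongr
        · exact tail_antitone (by gcongr; linarith)
  have hp := hF.tail_pos x₁
  refine ⟨2 / tail F x₁, ?_, K, fun w t ht => ?_⟩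
  · rw [le_div_iff₀ hp]; linarith [tail_le_one (F := F) x₁]
  have ht0 : 0 ≤ t ^ K := by positivity
  rcases le_or_gt x₁ w with hw | hw
  · refine (hbig w t hw ht).trans ?_
    gcongr
    · exact tail_nonneg _ _
    · rw [le_div_iff₀ hp]; linarith [tail_le_one (F := F) x₁]
  -- For small `w` the tail is at most `1`, and the bound at `x₁` is used instead at the price of
  -- dividing by `tail F x₁`.
  · have h3 := hbig x₁ t le_rfl ht
    calc tail F w ≤ 1 := tail_le_one _
      _ = (tail F x₁)⁻¹ * tail F x₁ := by field_simp
      _ ≤ (tail F x₁)⁻¹ * (2 * t ^ K * tail F (t * x₁)) := by gcongr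
      _ ≤ (tail F x₁)⁻¹ * (2 * t ^ K * tail F (t * w)) := by
        gcongr; exact tail_antitone (by gcongr)
      _ = _ := by ring

lemma IsIRV.tail_mul_le [IsProbabilityMeasure F] (hF : IsIRV F) {c : ℝ} (hc : 0 < c) :
    ∃ C : ℝ, 0 < C ∧ ∀ x, 0 ≤ x → tail F (c * x) ≤ C * tail F x := by
  obtain ⟨C, hC, K, h⟩ := hF.potter
  rcases le_or_gt 1 c with h1 | h1
  · exact ⟨1, one_pos, fun x hx => by
      rw [one_mul]; exact tail_antitone (le_mul_of_one_le_left hx h1)⟩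
  · refine ⟨C * c⁻¹ ^ K, by positivity, fun x _ => ?_⟩
    have := h (c * x) c⁻¹ ((one_le_inv₀ hc).2 h1.le)
    rwa [inv_mul_cancel_left₀ hc.ne'] at this

/-- The Potter bound, started at `1`, keeps the tail above a constant times `x ^ (-K)`. -/
lemma IsIRV.exp_isLittleO [IsProbabilityMeasure F] (hF : IsIRV F) {c : ℝ} (hc : 0 < c) :
    (fun x => Real.exp (-(c * x))) =o[atTop] tail F := by
  obtain ⟨C, hC, K, h⟩ := hF.potter
  have h1 : (fun x : ℝ => Real.exp (-(c * x))) =o[atTop] fun x => x ^ (-(K : ℝ)) := by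
    simpa using isLittleO_exp_neg_mul_rpow_atTop hc (-(K : ℝ))
  refine h1.trans_isBigO ?_
  refine IsBigO.of_bound (C / tail F 1) ?_
  filter_upwards [eventually_ge_atTop 1] with x hx
  have hx0 : 0 < x := by linarith
  have h2 := h 1 x hx
  rw [mul_one] at h2
  rw [Real.rpow_neg hx0.le, Real.rpow_natCast, Real.norm_of_nonneg (by positivity),
    Real.norm_of_nonneg (tail_nonneg _ _)]
  rw [inv_le_iff_one_le_mul₀ (by positivity)]
  have := hF.tail_pos 1
  rw [div_mul_eq_mul_div, div_mul_eq_mul_div, le_div_iff₀ this]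
  linarith

end Tail

/-! ### A heavy-tailed large deviation bound, uniform in the number of summands. -/

section LargeDeviation

variable {G : Measure ℝ}

/-- Truncation of a number to `0` above the level `h`. -/
noncomputable def truncAbove (h y : ℝ) : ℝ := if y ≤ h then y else 0

lemma measurable_truncAbove (h : ℝ) : Measurable (truncAbove h) :=
  Measurable.ite measurableSet_Iic measurable_id measurable_const

/-- The argument is split at `y = ε / s`: below, `u = s * y ≤ ε ≤ 1` gives `exp u ≤ 1 + u + u² ≤ 1 +
(1 + ε) u`; above, the truncation gives the crude bound `exp (s * h)`. -/
lemma exp_truncAbove_le {s h ε y : ℝ} (hs : 0 < s) (hε0 : 0 < ε) (hε : ε ≤ 1)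
    (hy : 0 ≤ y) :
    Real.exp (s * truncAbove h y) ≤
      1 + (1 + ε) * s * y + Real.exp (s * h) * (Set.Ioi (ε / s)).indicator 1 y := by
  have hind : 0 ≤ (Set.Ioi (ε / s)).indicator (1 : ℝ → ℝ) y :=
    Set.indicator_nonneg (fun _ _ => zero_le_one) _
  have h1 : 0 ≤ (1 + ε) * s * y := by positivity
  have h2 := Real.exp_pos (s * h)
  unfold truncAbove
  split_ifs with hyh
  · rcases le_or_gt y (ε / s) with hw | hw
    · have h3 : s * y ≤ ε := by rwa [le_div_iff₀ hs, mul_comm] at hw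
      have h0 : 0 ≤ s * y := by positivity
      have h4 := Real.abs_exp_sub_one_sub_id_le (x := s * y) (by rw [abs_of_nonneg h0]; linarith)
      have h5 := (abs_le.1 h4).2
      have h6 := mul_nonneg h2.le hind
      nlinarith
    · rw [Set.indicator_of_mem (show y ∈ Set.Ioi (ε / s) from hw)]
      have : Real.exp (s * y) ≤ Real.exp (s * h) := Real.exp_le_exp.2 (by gcongr)
      simp only [Pi.one_apply]
      linarith
  · rw [mul_zero, Real.exp_zero]
    have := mul_nonneg h2.le hind
    linarith

lemma integral_exp_truncAbove_le (hG : IsNonnegLawWithMean G) {s h ε : ℝ} (hs : 0 < s)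
    (hε0 : 0 < ε) (hε : ε ≤ 1) :
    Integrable (fun y => Real.exp (s * truncAbove h y)) G ∧
    ∫ y, Real.exp (s * truncAbove h y) ∂G ≤
      1 + (1 + ε) * s * mean G + Real.exp (s * h) * tail G (ε / s) := by
  have := hG.isProb
  have hi : Integrable (fun y : ℝ => 1 + (1 + ε) * s * y +
      Real.exp (s * h) * (Set.Ioi (ε / s)).indicator 1 y) G := by
    refine ((integrable_const _).add (hG.integrable.const_mul _)).add ?_
    exact ((integrable_const (1 : ℝ)).indicator measurableSet_Ioi).const_mul _
  have hle : ∀ᵐ y ∂G, Real.exp (s * truncAbove h y) ≤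
      1 + (1 + ε) * s * y + Real.exp (s * h) * (Set.Ioi (ε / s)).indicator 1 y := by
    filter_upwards [hG.nonneg] with y hy using exp_truncAbove_le hs hε0 hε hy
  have hint : Integrable (fun y => Real.exp (s * truncAbove h y)) G := by
    refine hi.mono' ?_ ?_
    · exact ((measurable_truncAbove h).const_mul s).exp.aestronglyMeasurable
    · filter_upwards [hle] with y hy
      rwa [Real.norm_of_nonneg (Real.exp_pos _).le]
  refine ⟨hint, (integral_mono_ae hint hi hle).trans_eq ?_⟩
  have hj : Integrable (fun y : ℝ => 1 + (1 + ε) * s * y) G :=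
    (integrable_const _).add (hG.integrable.const_mul _)
  have hk : Integrable (fun y : ℝ => Real.exp (s * h) * (Set.Ioi (ε / s)).indicator 1 y) G :=
    ((integrable_const (1 : ℝ)).indicator measurableSet_Ioi).const_mul _
  rw [integral_add hj hk, integral_add (integrable_const _) (hG.integrable.const_mul _),
    integral_const_mul, integral_const_mul, integral_indicator_one measurableSet_Ioi]
  simp [mean, tail]

lemma IsNonnegLawWithMean.mean_nonneg (hG : IsNonnegLawWithMean G) : 0 ≤ mean G :=
  integral_nonneg_of_ae hG.nonneg

variable {Ω : Type*} [MeasurableSpace Ω] {P : Measure Ω}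

lemma real_lt_eq_tail {Y : Ω → ℝ} (hY : Measurable Y) (hlaw : P.map Y = G) (x : ℝ) :
    P.real {ω | x < Y ω} = tail G x := by
  rw [tail, ← hlaw, map_measureReal_apply hY measurableSet_Ioi]; rfl

/-- A bound for large deviations of sums with dominatedly varying tails which is uniform in the
number of summands. -/
lemma exists_large_deviation_bound [IsProbabilityMeasure P] {Y : ℕ → Ω → ℝ} (hm : ∀ i, Measurable (Y i))
    (hind : iIndepFun Y P) (hlaw : ∀ i, P.map (Y i) = G) (hG : IsNonnegLawWithMean G)
    (hirv : IsIRV G) {c : ℝ} (hc : mean G < c) :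
    ∃ C, 0 < C ∧ ∀ (n : ℕ) (x : ℝ), 0 < x →
      P.real {ω | c * n + x < ∑ i ∈ Finset.range n, Y i ω} ≤ C * (n * tail G x) := by
  have := hG.isProb
  have hb := hG.mean_nonneg
  obtain ⟨C₀, hC₀, K, hpot⟩ := hirv.potter
  obtain ⟨C₁, hC₁, hhalf⟩ := hirv.tail_mul_le (c := 1 / 2) (by norm_num)
  -- Small enough that the drift `(1 + ε) * mean G` in the exponential moment stays below `c`.
  set ε := (c - mean G) / (c + 1) with hεdef
  have hc1 : 0 < c + 1 := by linarith
  have hε0 : 0 < ε := div_pos (by linarith) hc1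
  have hε1 : ε ≤ 1 := by rw [hεdef, div_le_one hc1]; linarith
  have hεc : (1 + ε) * mean G ≤ c := by
    have h1 : ε * (c + 1) = c - mean G := by rw [hεdef]; field_simp
    nlinarith
  set B := C₀ * (ε⁻¹) ^ K * K.factorial with hB
  have hB0 : 0 ≤ B := by positivity
  have key : ∀ (n : ℕ) (x : ℝ), 0 < x →
      P.real {ω | c * n + x < ∑ i ∈ Finset.range n, Y i ω} ≤
        (1 + Real.exp B + Real.exp 2) * (n * tail G (1 / 2 * x)) := by
    intro n x hx
    set h := 1 / 2 * x with hh
    have hh0 : 0 < h := by positivity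
    set u := n * tail G h with hu
    have hu0 : 0 ≤ u := mul_nonneg n.cast_nonneg (tail_nonneg _ _)
    have hsplit : 0 ≤ (1 + Real.exp B) * u := by positivity
    -- If `u` is not small the bound is trivial; otherwise `θ ≥ 1` below, as the Potter bound with
    -- dilation `θ / ε` requires.
    rcases le_or_gt (Real.exp (-2)) u with hcase | hcase
    · calc P.real {ω | c * n + x < ∑ i ∈ Finset.range n, Y i ω} ≤ 1 := measureReal_le_one
        _ = Real.exp 2 * Real.exp (-2) := by rw [← Real.exp_add]; simp
        _ ≤ Real.exp 2 * u := by gcongr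
        _ ≤ _ := by linarith
    rcases Nat.eq_zero_or_pos n with hn | hn
    · subst hn
      simp [u, hx.not_gt]
    have hn0 : (0 : ℝ) < n := by exact_mod_cast hn
    have hupos : 0 < u := mul_pos hn0 (hirv.tail_pos h)
    -- With `s * h = θ` and `x = 2 * h`, the Chernoff factor `exp (-s * x)` equals `exp (-2θ) = u`,
    -- the order of the probability of one big summand.
    set θ := -(Real.log u) / 2 with hθ
    have hθu : u = Real.exp (-(2 * θ)) := by
      rw [hθ, show -(2 * (-(Real.log u) / 2)) = Real.log u by ring, Real.exp_log hupos]
    have hθ1 : 1 ≤ θ := by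
      rw [hθu] at hcase
      have := Real.exp_lt_exp.1 hcase
      linarith
    set s := θ / h with hs
    have hs0 : 0 < s := by positivity
    have hsh : s * h = θ := by rw [hs]; field_simp
    set q := Real.exp θ * tail G (ε / s) with hq
    have hq0 : 0 ≤ q := mul_nonneg (Real.exp_pos _).le (tail_nonneg _ _)
    -- The correction to the exponential moment stays bounded after `n` factors: Potter replaces
    -- `tail G (ε / s)` by a power of `θ` times `tail G h`, `θ ^ K ≤ K! * exp θ` absorbs the power,
    -- and `exp (2θ) * u = 1`.
    have hnq : n * q ≤ B := by
      have ht : 1 ≤ θ / ε := by rw [le_div_iff₀ hε0]; linarith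
      have h1 := hpot (ε / s) (θ / ε) ht
      have h2 : θ / ε * (ε / s) = h := by rw [hs]; field_simp
      rw [h2] at h1
      have h3 : θ ^ K ≤ K.factorial * Real.exp θ := by
        have := Real.pow_div_factorial_le_exp θ (by linarith) K
        rwa [div_le_iff₀ (by positivity), mul_comm] at this
      calc n * q ≤ n * (Real.exp θ * (C₀ * (θ / ε) ^ K * tail G h)) := by
            rw [hq]; gcongr
        _ = C₀ * (ε⁻¹) ^ K * (Real.exp θ * u) * θ ^ K := by
            rw [hu, div_eq_mul_inv, mul_pow]; ring
        _ ≤ C₀ * (ε⁻¹) ^ K * (Real.exp θ * u) * (K.factorial * Real.exp θ) := by gcongr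
        _ = B * (Real.exp θ * Real.exp θ * u) := by rw [hB]; ring
        _ = B := by rw [hθu, ← Real.exp_add, ← Real.exp_add]; ring_nf; simp
    have hone : ∀ i, Integrable (fun ω => Real.exp (s * truncAbove h (Y i ω))) P ∧
        mgf (truncAbove h ∘ Y i) P s ≤ Real.exp (s * c + q) := by
      intro i
      obtain ⟨h1, h2⟩ := integral_exp_truncAbove_le hG hs0 hε0 hε1
      have hms : AEStronglyMeasurable (fun y => Real.exp (s * truncAbove h y)) (P.map (Y i)) :=
        ((measurable_truncAbove h).const_mul s).exp.aestronglyMeasurable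
      rw [← hlaw i] at h1
      refine ⟨(integrable_map_measure hms (hm i).aemeasurable).1 h1, ?_⟩
      have h3 : mgf (truncAbove h ∘ Y i) P s = ∫ y, Real.exp (s * truncAbove h y) ∂G := by
        rw [← hlaw i, integral_map (hm i).aemeasurable hms]; rfl
      rw [h3]
      refine h2.trans (le_trans ?_ (Real.add_one_le_exp (s * c + q)))
      rw [hsh, ← hq]
      nlinarith
    have hindT : iIndepFun (fun i => truncAbove h ∘ Y i) P :=
      hind.comp (fun _ => truncAbove h) (fun _ => measurable_truncAbove h)
    have hmT : ∀ i, Measurable (truncAbove h ∘ Y i) := fun i => (measurable_truncAbove h).comp (hm i)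
    have hsum : P.real {ω | c * n + x ≤ (∑ i ∈ Finset.range n, truncAbove h ∘ Y i) ω} ≤
        Real.exp B * u := by
      have h1 := measure_ge_le_exp_mul_mgf (μ := P)
        (X := ∑ i ∈ Finset.range n, truncAbove h ∘ Y i) (c * n + x) hs0.le
        (hindT.integrable_exp_mul_sum hmT (fun i _ => (hone i).1))
      refine h1.trans ?_
      rw [hindT.mgf_sum hmT]
      calc Real.exp (-s * (c * n + x)) * ∏ i ∈ Finset.range n, mgf (truncAbove h ∘ Y i) P s
          ≤ Real.exp (-s * (c * n + x)) * ∏ i ∈ Finset.range n, Real.exp (s * c + q) := by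
            gcongr with i
            · exact fun i _ => mgf_nonneg
            · exact (hone i).2
        _ = Real.exp (n * q + -(2 * θ)) := by
            rw [Finset.prod_const, Finset.card_range, ← Real.exp_nat_mul, ← Real.exp_add]
            congr 1
            rw [← hsh, hh]; ring
        _ ≤ Real.exp B * u := by
            rw [Real.exp_add, ← hθu]; gcongr
    have hmax : P.real (⋃ i ∈ Finset.range n, {ω | h < Y i ω}) ≤ u := by
      refine (measureReal_biUnion_finset_le _ _).trans ?_
      simp_rw [fun i => real_lt_eq_tail (hm i) (hlaw i) h]
      simp [hu]
    -- Either some summand exceeds `h`, or truncation changes nothing.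
    have hsub : {ω | c * n + x < ∑ i ∈ Finset.range n, Y i ω} ⊆
        (⋃ i ∈ Finset.range n, {ω | h < Y i ω}) ∪
        {ω | c * n + x ≤ (∑ i ∈ Finset.range n, truncAbove h ∘ Y i) ω} := by
      intro ω hω
      by_cases hex : ∃ i ∈ Finset.range n, h < Y i ω
      · left; simpa using hex
      · right
        push Not at hex
        simp only [Set.mem_ofPred_eq, Finset.sum_apply, Function.comp_apply] at hω ⊢
        rw [Finset.sum_congr rfl (fun i hi => show truncAbove h (Y i ω) = Y i ω from
          if_pos (hex i hi))]
        exact hω.le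
    calc P.real {ω | c * n + x < ∑ i ∈ Finset.range n, Y i ω} ≤ u + Real.exp B * u :=
          (measureReal_mono hsub).trans ((measureReal_union_le _ _).trans (add_le_add hmax hsum))
      _ ≤ _ := by have := mul_nonneg (Real.exp_pos 2).le hu0; linarith
  refine ⟨(1 + Real.exp B + Real.exp 2) * C₁, by positivity, fun n x hx => (key n x hx).trans ?_⟩
  calc _ ≤ (1 + Real.exp B + Real.exp 2) * (n * (C₁ * tail G x)) := by
        gcongr; exact hhalf x hx.le
    _ = _ := by ring

end LargeDeviation

/-! ### Randomly stopped sums and the single big summand. -/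

section RandomSum

variable {Ω : Type*} {m₁ m₂ : MeasurableSpace Ω} [mΩ : MeasurableSpace Ω] {P : Measure Ω}
  [IsProbabilityMeasure P]

lemma hasSum_measureReal_inter_fiber {N : Ω → ℕ} (hN : Measurable N) {E : Set Ω}
    (hE : MeasurableSet E) : HasSum (fun n => P.real (E ∩ N ⁻¹' {n})) (P.real E) := by
  have h := hasSum_integral_iUnion (μ := P) (f := fun _ => (1 : ℝ)) (s := fun n => E ∩ N ⁻¹' {n})
    (fun n => hE.inter (hN (measurableSet_singleton n)))
    (fun i j hij => Set.disjoint_left.2 fun ω h1 h2 => hij (h1.2.symm.trans h2.2))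
    (integrable_const _).integrableOn
  have hU : ⋃ n, E ∩ N ⁻¹' {n} = E := by
    ext ω; simp
  simpa [hU] using h

lemma hasSum_succ_mul_measureReal_fiber {N : Ω → ℕ} (hN : Measurable N)
    (hNi : Integrable (fun ω => (N ω : ℝ)) P) :
    HasSum (fun n : ℕ => ((n : ℝ) + 1) * P.real (N ⁻¹' {n})) (∫ ω, (1 + (N ω : ℝ)) ∂P) := by
  have h := hasSum_integral_iUnion (μ := P) (f := fun ω => 1 + (N ω : ℝ))
    (s := fun n => N ⁻¹' {n}) (fun n => hN (measurableSet_singleton n))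
    (fun i j hij => Set.disjoint_left.2 fun ω h1 h2 => hij (h1.symm.trans h2))
    ((integrable_const _).add hNi).integrableOn
  have hU : ⋃ n, N ⁻¹' {n} = Set.univ := by
    ext ω; simp
  rw [hU, setIntegral_univ] at h
  have hfun : (fun n : ℕ => ((n : ℝ) + 1) * P.real (N ⁻¹' {n})) =
      fun n => ∫ ω in N ⁻¹' {n}, (1 + (N ω : ℝ)) ∂P := by
    funext n
    rw [setIntegral_congr_fun (g := fun _ => (n : ℝ) + 1) (hN (measurableSet_singleton n))
    (fun ω hω => by
      have : N ω = n := hω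
      simp [this, add_comm])]
    simp [mul_comm]
  rwa [hfun]

omit [IsProbabilityMeasure P] in
lemma Indep.measureReal_inter (h : Indep m₁ m₂ P) {A B : Set Ω}
    (hA : MeasurableSet[m₁] A) (hB : MeasurableSet[m₂] B) :
    P.real (A ∩ B) = P.real A * P.real B := by
  simp only [Measure.real]
  rw [← ENNReal.toReal_mul, (Indep_iff _ _ _).1 h A B hA hB]

/-- At most one term exceeds `τ`; it is bounded by `A` and all the others by `τ`. -/
lemma sum_le_of_no_two_large {n : ℕ} {y : ℕ → ℝ} {A τ : ℝ} (hA : 0 ≤ A) (hτ : 0 ≤ τ)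
    (h1 : ∀ i < n + 1, y i ≤ A)
    (h2 : ∀ i < n + 1, ∀ j < n + 1, i ≠ j → τ < y i → y j ≤ τ) :
    ∑ i ∈ Finset.range (n + 1), y i ≤ A + (n + 1) * τ := by
  by_cases hex : ∃ i < n + 1, τ < y i
  · obtain ⟨i, hi, hyi⟩ := hex
    rw [← Finset.add_sum_erase _ _ (Finset.mem_range.2 hi)]
    refine add_le_add (h1 i hi) ?_
    calc ∑ j ∈ (Finset.range (n + 1)).erase i, y j
        ≤ ∑ j ∈ (Finset.range (n + 1)).erase i, τ := Finset.sum_le_sum fun j hj => by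
          rw [Finset.mem_erase, Finset.mem_range] at hj
          exact h2 i hi j hj.2 hj.1.symm hyi
      _ ≤ (n + 1) * τ := by
          rw [Finset.sum_const, Finset.card_erase_of_mem (Finset.mem_range.2 hi),
            Finset.card_range, nsmul_eq_mul]
          gcongr
          push_cast
          simp
  · push Not at hex
    calc ∑ i ∈ Finset.range (n + 1), y i ≤ ∑ i ∈ Finset.range (n + 1), τ :=
          Finset.sum_le_sum fun i hi => hex i (Finset.mem_range.1 hi)
      _ ≤ _ := by simp; exact hA

variable {G : Measure ℝ} {Y : ℕ → Ω → ℝ} {N : Ω → ℕ} {W : Ω → ℝ}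

/-- On `N = n` there are `n + 1` candidates, each independent of `N`; the union bound is then
averaged over `n`. -/
lemma measureReal_exists_lt_le (hm₁ : m₁ ≤ mΩ) (hm₂ : m₂ ≤ mΩ) (hm : Indep m₁ m₂ P)
    (hY : ∀ i, Measurable[m₂] (Y i)) (hN : Measurable[m₁] N) (hlaw : ∀ i, P.map (Y i) = G)
    (hNi : Integrable (fun ω => (N ω : ℝ)) P) (y : ℝ) :
    P.real {ω | ∃ i ≤ N ω, y < Y i ω} ≤ (∫ ω, (1 + (N ω : ℝ)) ∂P) * tail G y := by
  have hN' : Measurable N := hN.mono hm₁ le_rfl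
  have hY' : ∀ i, Measurable (Y i) := fun i => (hY i).mono hm₂ le_rfl
  have hEm : MeasurableSet {ω | ∃ i ≤ N ω, y < Y i ω} := by
    have : {ω | ∃ i ≤ N ω, y < Y i ω} = ⋃ i, ({ω | i ≤ N ω} ∩ {ω | y < Y i ω}) := by
      ext; simp
    rw [this]
    exact MeasurableSet.iUnion fun i => (measurableSet_le measurable_const hN').inter
      (measurableSet_lt measurable_const (hY' i))
  refine hasSum_le (fun n => ?_) (hasSum_measureReal_inter_fiber (P := P) hN' hEm)
    ((hasSum_succ_mul_measureReal_fiber hN' hNi).mul_right (tail G y))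
  have hsub : {ω | ∃ i ≤ N ω, y < Y i ω} ∩ N ⁻¹' {n} ⊆
      ⋃ i ∈ Finset.range (n + 1), (N ⁻¹' {n} ∩ {ω | y < Y i ω}) := by
    rintro ω ⟨⟨i, hi, hy⟩, hn⟩
    have hn' : N ω = n := hn
    simp only [Set.mem_iUnion, Finset.mem_range]
    exact ⟨i, by omega, hn, hy⟩
  refine (measureReal_mono hsub (measure_ne_top _ _)).trans ((measureReal_biUnion_finset_le _ _).trans ?_)
  rw [Finset.sum_congr rfl fun i _ => (Indep.measureReal_inter hm
    (hN (measurableSet_singleton n))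
    (measurableSet_lt measurable_const (hY i))).trans
      (by rw [real_lt_eq_tail (hY' i) (hlaw i)])]
  simp [mul_assoc]

/-- Upper tail bound for a randomly stopped sum plus a linear function of the stopping data. -/
lemma eventually_random_sum_tail_le (hm₁ : m₁ ≤ mΩ) (hm₂ : m₂ ≤ mΩ) (hm : Indep m₁ m₂ P)
    (hY : ∀ i, Measurable[m₂] (Y i)) (hN : Measurable[m₁] N) (hW : Measurable[m₁] W)
    (hind : iIndepFun Y P) (hlaw : ∀ i, P.map (Y i) = G)
    (hNi : Integrable (fun ω => (N ω : ℝ)) P) (hG : IsNonnegLawWithMean G) (hirv : IsIRV G)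
    {a γ c ρ ε : ℝ} (hγ : 0 < γ) (hc : mean G < c) (hρ0 : 0 < ρ) (hρ1 : ρ < 1) (hε : 0 < ε) :
    ∀ᶠ x in atTop,
      P.real {ω | x < W ω + a * N ω + γ * ∑ i ∈ Finset.range (N ω + 1), Y i ω} ≤
        P.real {ω | ρ * x < W ω + (a + γ * c) * N ω} +
        (∫ ω, (1 + (N ω : ℝ)) ∂P) * tail G (ρ * x / γ) + ε * tail G x := by
  have := hG.isProb
  have hN' : Measurable N := hN.mono hm₁ le_rfl
  have hW' : Measurable W := hW.mono hm₁ le_rfl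
  have hY' : ∀ i, Measurable (Y i) := fun i => (hY i).mono hm₂ le_rfl
  have hc0 : 0 ≤ c := hG.mean_nonneg.trans hc.le
  obtain ⟨C, hC, hLD⟩ := exists_large_deviation_bound hY' hind hlaw hG hirv hc
  -- Half of the slack `(1 - ρ) * x / γ`; the other half absorbs the extra `c` due to having `N + 1`
  -- rather than `N` summands.
  set κ := (1 - ρ) / (2 * γ) with hκ
  have hκ0 : 0 < κ := div_pos (by linarith) (by positivity)
  obtain ⟨C₁, hC₁, hκt⟩ := hirv.tail_mul_le hκ0
  set S : ℕ → Ω → ℝ := fun n ω => ∑ i ∈ Finset.range n, Y i ω with hS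
  have hSm₂ : ∀ n, Measurable[m₂] (S n) := fun n => Finset.measurable_sum _ fun i _ => hY i
  have hSN : Measurable fun ω => S (N ω + 1) ω := by
    have h1 : Measurable fun q : ℕ × Ω => S (q.1 + 1) q.2 :=
      measurable_from_prod_countable_right fun n => (hSm₂ (n + 1)).mono hm₂ le_rfl
    exact h1.comp (hN'.prodMk measurable_id)
  -- The exceedances explained neither by the averaged linear functional nor by one large summand.
  -- They are to be shown `o(tail G x)`.
  set E : ℝ → Set Ω := fun x => {ω | x < W ω + a * N ω + γ * S (N ω + 1) ω ∧
    W ω + (a + γ * c) * N ω ≤ ρ * x ∧ ¬ ∃ i ≤ N ω, ρ * x / γ < Y i ω} with hE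
  have hEm : ∀ x, MeasurableSet (E x) := by
    intro x
    have hNr : Measurable fun ω => (N ω : ℝ) := measurable_from_nat.comp hN'
    have h3 : MeasurableSet {ω | ∃ i ≤ N ω, ρ * x / γ < Y i ω} := by
      have : {ω | ∃ i ≤ N ω, ρ * x / γ < Y i ω} =
          ⋃ i, ({ω | i ≤ N ω} ∩ {ω | ρ * x / γ < Y i ω}) := by ext; simp
      rw [this]
      exact MeasurableSet.iUnion fun i => (measurableSet_le measurable_const hN').inter
        (measurableSet_lt measurable_const (hY' i))
    exact (measurableSet_lt measurable_const ((hW'.add (hNr.const_mul a)).add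
      (hSN.const_mul γ))).inter ((measurableSet_le (hW'.add (hNr.const_mul _))
      measurable_const).inter h3.compl)
  have hmajor : ∀ᶠ x in atTop, ∀ n, E x ∩ N ⁻¹' {n} ⊆
      N ⁻¹' {n} ∩ {ω | c * (n + 1 : ℕ) + κ * x < S (n + 1) ω} := by
    filter_upwards [eventually_ge_atTop (c / κ)] with x hx n ω ⟨⟨h1, h2, _⟩, hn⟩
    have hn' : N ω = n := hn
    rw [hn'] at h1 h2
    refine ⟨hn, ?_⟩
    rw [div_le_iff₀ hκ0] at hx
    have h3 : γ * (κ * x) * 2 = (1 - ρ) * x := by rw [hκ]; field_simp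
    have h4 : γ * (c * (n + 1) + κ * x) < γ * S (n + 1) ω := by
      have : γ * c ≤ γ * (x * κ) := by gcongr
      nlinarith
    have := lt_of_mul_lt_mul_left h4 hγ.le
    simpa using this
  -- Dominated convergence over the value `n` of `N`: the uniform large deviation bound dominates by
  -- a multiple of `(n + 1) * P(N = n)`, summable since `N` has finite mean.
  have hratio : Tendsto (fun x => ∑' n, P.real (E x ∩ N ⁻¹' {n}) / tail G x) atTop (𝓝 0) := by
    have hz : (0 : ℝ) = ∑' n : ℕ, (0 : ℝ) := by simp
    rw [hz]
    refine tendsto_tsum_of_dominated_convergence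
      (bound := fun n : ℕ => C * C₁ * (((n : ℝ) + 1) * P.real (N ⁻¹' {n})))
      ((hasSum_succ_mul_measureReal_fiber hN' hNi).summable.mul_left _) (fun n => ?_) ?_
    -- The slack is cut into quarters: one for `W`, one for `a * n`, and two for the `n + 1`
    -- summands of size at most `τ * x`.
    · set η := (1 - ρ) / 4 with hη
      have hη0 : 0 < η := by rw [hη]; linarith
      set τ := 2 * η / (γ * (n + 1)) with hτ
      have hτ0 : 0 < τ := by positivity
      obtain ⟨C₂, hC₂, hτt⟩ := hirv.tail_mul_le hτ0
      have hlim : Tendsto (fun x => tail (P.map W) (η * x) * (C * C₁ * ((n : ℝ) + 1)) +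
          (n + 1) * (n + 1) * (C₂ * C₂ * tail G x)) atTop (𝓝 0) := by
        have : IsProbabilityMeasure (P.map W) := Measure.isProbabilityMeasure_map hW'.aemeasurable
        have h1 : Tendsto (fun x => tail (P.map W) (η * x)) atTop (𝓝 0) :=
          tail_tendsto_zero.comp (tendsto_id.const_mul_atTop hη0)
        have h2 := (h1.mul_const (C * C₁ * ((n : ℝ) + 1))).add
          (((tail_tendsto_zero (F := G)).const_mul (C₂ * C₂)).const_mul (((n : ℝ) + 1) * (n + 1)))
        simpa using h2
      refine tendsto_of_tendsto_of_tendsto_of_le_of_le' tendsto_const_nhds hlim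
        (Eventually.of_forall fun x => div_nonneg measureReal_nonneg (tail_nonneg _ _)) ?_
      filter_upwards [hmajor, eventually_gt_atTop 0, eventually_ge_atTop (a * n / η)]
        with x hx hx0 hxa
      rw [div_le_iff₀ hη0] at hxa
      rw [div_le_iff₀ (hirv.tail_pos x)]
      -- For fixed `n` the event requires two independent rare causes: `W` and the sum both large,
      -- or two distinct summands both large. Each has probability `o(tail G x)`.
      have hsub : E x ∩ N ⁻¹' {n} ⊆
          ({ω | η * x < W ω} ∩ {ω | c * (n + 1 : ℕ) + κ * x < S (n + 1) ω}) ∪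
          ⋃ i ∈ Finset.range (n + 1), ⋃ j ∈ (Finset.range (n + 1)).erase i,
            ({ω | τ * x < Y i ω} ∩ {ω | τ * x < Y j ω}) := by
        intro ω hω
        rcases lt_or_ge (η * x) (W ω) with hWx | hWx
        · exact Or.inl ⟨hWx, (hx n hω).2⟩
        right
        by_contra hcon
        simp only [Set.mem_iUnion, Finset.mem_range, Finset.mem_erase, not_exists,
          Set.mem_inter_iff, Set.mem_ofPred_eq, not_and, not_lt] at hcon
        obtain ⟨⟨h1, h2, h3⟩, hn⟩ := hω
        have hn' : N ω = n := hn
        rw [hn'] at h1 h2 h3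
        push Not at h3
        have h4 := sum_le_of_no_two_large (n := n) (y := fun i => Y i ω) (A := ρ * x / γ)
          (τ := τ * x) (by positivity) (by positivity) (fun i hi => h3 i (by omega))
          (fun i hi j hj hij h => hcon i hi j ⟨Ne.symm hij, hj⟩ h)
        have h5 : γ * S (n + 1) ω ≤ ρ * x + 2 * η * x := by
          calc γ * S (n + 1) ω ≤ γ * (ρ * x / γ + (n + 1) * (τ * x)) := by gcongr
            _ = _ := by rw [hτ]; field_simp
        have h6 : ρ + 2 * η = 1 - 2 * η := by rw [hη]; ring
        have h7 : ρ * x + 2 * η * x = x - 2 * η * x := by rw [← add_mul, h6]; ring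
        linarith
      refine (measureReal_mono hsub (measure_ne_top _ _)).trans ((measureReal_union_le _ _).trans ?_)
      rw [add_mul]
      refine add_le_add ?_ ?_
      · rw [Indep.measureReal_inter hm (measurableSet_lt measurable_const hW)
          (measurableSet_lt measurable_const (hSm₂ (n + 1))), real_lt_eq_tail hW' rfl, mul_assoc]
        refine mul_le_mul_of_nonneg_left ?_ (tail_nonneg _ _)
        calc _ ≤ C * ((n + 1 : ℕ) * tail G (κ * x)) := hLD (n + 1) _ (by positivity)
          _ ≤ C * ((n + 1 : ℕ) * (C₁ * tail G x)) := by gcongr; exact hκt x hx0.le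
          _ = _ := by push_cast; ring
      · have hpair : ∀ i ∈ Finset.range (n + 1), ∀ j ∈ (Finset.range (n + 1)).erase i,
            P.real ({ω | τ * x < Y i ω} ∩ {ω | τ * x < Y j ω}) ≤
              C₂ * C₂ * tail G x * tail G x := by
          intro i _ j hj
          have hij : i ≠ j := (Finset.ne_of_mem_erase hj).symm
          have h1 := (hind.indepFun hij).measure_inter_preimage_eq_mul (Set.Ioi (τ * x))
            (Set.Ioi (τ * x)) measurableSet_Ioi measurableSet_Ioi
          have h2 : P.real ({ω | τ * x < Y i ω} ∩ {ω | τ * x < Y j ω}) =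
              tail G (τ * x) * tail G (τ * x) := by
            rw [← real_lt_eq_tail (hY' i) (hlaw i)]
            nth_rewrite 2 [real_lt_eq_tail (hY' i) (hlaw i)]
            rw [← real_lt_eq_tail (hY' j) (hlaw j)]
            simp only [Measure.real]
            rw [← ENNReal.toReal_mul]
            exact congrArg _ h1
          rw [h2]
          calc _ ≤ (C₂ * tail G x) * (C₂ * tail G x) :=
                mul_le_mul (hτt x hx0.le) (hτt x hx0.le) (tail_nonneg _ _)
                  (mul_nonneg hC₂.le (tail_nonneg _ _))
            _ = _ := by ring
        have hq : 0 ≤ C₂ * C₂ * tail G x * tail G x :=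
          mul_nonneg (mul_nonneg (by positivity) (tail_nonneg _ _)) (tail_nonneg _ _)
        refine (measureReal_biUnion_finset_le _ _).trans ?_
        calc _ ≤ ∑ i ∈ Finset.range (n + 1), ((n : ℝ) + 1) * (C₂ * C₂ * tail G x * tail G x) := by
              refine Finset.sum_le_sum fun i hi => ?_
              refine (measureReal_biUnion_finset_le _ _).trans ?_
              refine (Finset.sum_le_sum (hpair i hi)).trans ?_
              rw [Finset.sum_const, nsmul_eq_mul, Finset.card_erase_of_mem hi, Finset.card_range]
              gcongr
              push_cast
              simp
          _ = _ := by simp; ring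
    · filter_upwards [hmajor, eventually_gt_atTop 0] with x hx hx0 n
      rw [Real.norm_of_nonneg (div_nonneg measureReal_nonneg (tail_nonneg _ _)),
        div_le_iff₀ (hirv.tail_pos x)]
      refine (measureReal_mono (hx n)).trans ?_
      rw [Indep.measureReal_inter hm (hN (measurableSet_singleton n))
        (measurableSet_lt measurable_const (hSm₂ (n + 1)))]
      calc _ ≤ P.real (N ⁻¹' {n}) * (C * ((n + 1 : ℕ) * tail G (κ * x))) := by
            gcongr; exact hLD (n + 1) _ (by positivity)
        _ ≤ P.real (N ⁻¹' {n}) * (C * ((n + 1 : ℕ) * (C₁ * tail G x))) := by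
            gcongr; exact hκt x hx0.le
        _ = _ := by push_cast; ring
  filter_upwards [hratio.eventually (gt_mem_nhds hε)] with x hx
  have hEx : P.real (E x) ≤ ε * tail G x := by
    rw [tsum_div_const, (hasSum_measureReal_inter_fiber hN' (hEm x)).tsum_eq,
      div_lt_iff₀ (hirv.tail_pos x)] at hx
    exact hx.le
  have hsub : {ω | x < W ω + a * N ω + γ * ∑ i ∈ Finset.range (N ω + 1), Y i ω} ⊆
      ({ω | ρ * x < W ω + (a + γ * c) * N ω} ∪ {ω | ∃ i ≤ N ω, ρ * x / γ < Y i ω}) ∪ E x := by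
    intro ω hω
    by_cases h1 : ρ * x < W ω + (a + γ * c) * N ω
    · exact Or.inl (Or.inl h1)
    by_cases h2 : ∃ i ≤ N ω, ρ * x / γ < Y i ω
    · exact Or.inl (Or.inr h2)
    · exact Or.inr ⟨hω, not_lt.1 h1, h2⟩
  refine (measureReal_mono hsub (measure_ne_top _ _)).trans ((measureReal_union_le _ _).trans (add_le_add
    ((measureReal_union_le _ _).trans (add_le_add le_rfl ?_)) hEx))
  exact measureReal_exists_lt_le hm₁ hm₂ hm hY hN hlaw hNi _

end RandomSum

/-! ### Exponential bounds for sums of nonnegative variables falling below their mean slope. -/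

section LowerDeviation

variable {Ω : Type*} [MeasurableSpace Ω] {P : Measure Ω} [IsProbabilityMeasure P]

lemma measureReal_iUnion_le_tsum {A : ℕ → Set Ω} {u : ℕ → ℝ} (hu : Summable u)
    (h : ∀ n, P.real (A n) ≤ u n) : P.real (⋃ n, A n) ≤ ∑' n, u n := by
  have hu0 : ∀ n, 0 ≤ u n := fun n => measureReal_nonneg.trans (h n)
  refine ENNReal.toReal_le_of_le_ofReal (tsum_nonneg hu0) ?_
  rw [ENNReal.ofReal_tsum_of_nonneg hu0 hu]
  refine (measure_iUnion_le A).trans (ENNReal.tsum_le_tsum fun n => ?_)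
  rw [← ENNReal.ofReal_toReal (measure_ne_top P (A n))]
  exact ENNReal.ofReal_le_ofReal (h n)

lemma integrable_exp_neg_mul {F : Measure ℝ} (hF : IsNonnegLawWithMean F) {s : ℝ} (hs : 0 ≤ s) :
    Integrable (fun y => Real.exp (-s * y)) F := by
  have := hF.isProb
  refine (integrable_const (1 : ℝ)).mono'
    ((measurable_id.const_mul (-s)).exp.aestronglyMeasurable) ?_
  filter_upwards [hF.nonneg] with y hy
  rw [Real.norm_of_nonneg (Real.exp_pos _).le, Real.exp_le_one_iff]
  have := mul_nonneg hs hy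
  linarith

/-- The Laplace transform has right derivative `-mean F` at `0`, by dominated convergence with
majorant `y`; hence for small `s` it lies below `exp (-(s * θ))`. -/
lemma exists_integral_exp_neg_lt {F : Measure ℝ} (hF : IsNonnegLawWithMean F) {θ : ℝ}
    (hθ : θ < mean F) : ∃ s > 0, Real.exp (s * θ) * ∫ y, Real.exp (-s * y) ∂F < 1 := by
  have := hF.isProb
  have hlim : Tendsto (fun s : ℝ => ∫ y, s⁻¹ * (1 - Real.exp (-s * y)) ∂F) (𝓝[>] 0)
      (𝓝 (mean F)) := by
    refine tendsto_integral_filter_of_dominated_convergence (fun y => y) ?_ ?_ hF.integrable ?_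
    · exact Eventually.of_forall fun s => ((measurable_const.sub
        (measurable_id.const_mul (-s)).exp).const_mul _).aestronglyMeasurable
    · filter_upwards [self_mem_nhdsWithin] with s hs
      have hs0 : (0 : ℝ) < s := hs
      filter_upwards [hF.nonneg] with y hy
      have h1 : Real.exp (-s * y) ≤ 1 := by
        rw [Real.exp_le_one_iff]; have := mul_nonneg hs0.le hy; linarith
      rw [Real.norm_of_nonneg (mul_nonneg (inv_pos.2 hs0).le (by linarith)),
        inv_mul_le_iff₀ hs0]
      have := Real.add_one_le_exp (-s * y)
      linarith
    · refine Eventually.of_forall fun y => ?_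
      have hd : HasDerivAt (fun t : ℝ => -Real.exp (-t * y)) y 0 := by
        have h1 : HasDerivAt (fun t : ℝ => -t * y) (-1 * y) 0 :=
          ((hasDerivAt_id (0 : ℝ)).neg).mul_const y
        exact h1.exp.neg.congr_deriv (by simp)
      refine hd.tendsto_slope_zero_right.congr fun t => ?_
      simp only [smul_eq_mul, zero_add, neg_zero, zero_mul, Real.exp_zero]
      ring
  obtain ⟨s, h1, hs⟩ := ((hlim.eventually (lt_mem_nhds hθ)).and self_mem_nhdsWithin).exists
  have hs0 : (0 : ℝ) < s := hs
  refine ⟨s, hs0, ?_⟩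
  rw [integral_const_mul, integral_sub (integrable_const _) (integrable_exp_neg_mul hF hs0.le),
    integral_const, probReal_univ, one_smul, lt_inv_mul_iff₀ hs0] at h1
  have h2 : ∫ y, Real.exp (-s * y) ∂F < Real.exp (-(s * θ)) := by
    have := Real.add_one_le_exp (-(s * θ))
    linarith
  calc _ < Real.exp (s * θ) * Real.exp (-(s * θ)) := by gcongr
    _ = 1 := by rw [← Real.exp_add]; simp

/-- Sums of independent nonnegative variables fall below a line of smaller slope with
exponentially small probability, uniformly over shifts. -/
lemma exists_lower_deviation_bound {Y : ℕ → Ω → ℝ} {F : Measure ℝ} (hm : ∀ i, Measurable (Y i))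
    (hind : iIndepFun Y P) (hlaw : ∀ i, P.map (Y i) = F) (hF : IsNonnegLawWithMean F)
    {θ : ℝ} (hθ : θ < mean F) :
    ∃ s > 0, ∃ c, ∀ (k : ℕ) (z : ℝ),
      P.real {ω | ∃ m : ℕ, ∑ j ∈ Finset.range m, Y (k + j) ω < θ * m - z} ≤
        c * Real.exp (-(s * z)) := by
  obtain ⟨s, hs, hq⟩ := exists_integral_exp_neg_lt hF hθ
  set q := Real.exp (s * θ) * ∫ y, Real.exp (-s * y) ∂F with hqdef
  have hI0 : 0 ≤ ∫ y, Real.exp (-s * y) ∂F := integral_nonneg fun y => (Real.exp_pos _).le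
  have hq0 : 0 ≤ q := mul_nonneg (Real.exp_pos _).le hI0
  -- The Chernoff bound for `m` summands carries the factor `q ^ m`, and the union over `m` sums the
  -- geometric series.
  refine ⟨s, hs, (1 - q)⁻¹, fun k z => ?_⟩
  have hone : ∀ i, Integrable (fun ω => Real.exp (-s * Y i ω)) P ∧
      mgf (Y i) P (-s) = ∫ y, Real.exp (-s * y) ∂F := by
    intro i
    have hms : AEStronglyMeasurable (fun y => Real.exp (-s * y)) (P.map (Y i)) :=
      (measurable_id.const_mul (-s)).exp.aestronglyMeasurable
    have h1 := integrable_exp_neg_mul hF hs.le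
    rw [← hlaw i] at h1 ⊢
    exact ⟨(integrable_map_measure hms (hm i).aemeasurable).1 h1,
      (integral_map (hm i).aemeasurable hms).symm⟩
  have hindk : iIndepFun (fun j => Y (k + j)) P := hind.precomp (add_right_injective k)
  have hfix : ∀ m : ℕ, P.real {ω | ∑ j ∈ Finset.range m, Y (k + j) ω < θ * m - z} ≤
      Real.exp (-(s * z)) * q ^ m := by
    intro m
    have h1 := measure_le_le_exp_mul_mgf (μ := P) (t := -s)
      (X := ∑ j ∈ Finset.range m, Y (k + j)) (θ * m - z) (by linarith)
      (hindk.integrable_exp_mul_sum (fun j => hm (k + j)) (fun j _ => (hone (k + j)).1))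
    rw [hindk.mgf_sum (fun j => hm (k + j)),
      Finset.prod_congr rfl (fun j _ => (hone (k + j)).2), Finset.prod_const,
      Finset.card_range] at h1
    refine (measureReal_mono ?_ (measure_ne_top _ _)).trans (h1.trans_eq ?_)
    · intro ω hω
      simp only [Set.mem_ofPred_eq, Finset.sum_apply] at hω ⊢
      exact hω.le
    · rw [hqdef, mul_pow, ← Real.exp_nat_mul, ← mul_assoc, ← Real.exp_add]
      congr 2
      ring
  have hU : {ω | ∃ m : ℕ, ∑ j ∈ Finset.range m, Y (k + j) ω < θ * m - z} =
      ⋃ m : ℕ, {ω | ∑ j ∈ Finset.range m, Y (k + j) ω < θ * m - z} := by ext; simp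
  rw [hU]
  refine (measureReal_iUnion_le_tsum
    ((summable_geometric_of_lt_one hq0 hq).mul_left _) hfix).trans_eq ?_
  rw [tsum_mul_left, tsum_geometric_of_lt_one hq0 hq, mul_comm]

/-- The allowance `δ * n` growing with the starting index `n` makes the union over all starting
points another geometric series. This controls arrivals after a random time. -/
lemma exists_shifted_lower_deviation_bound {Y : ℕ → Ω → ℝ} {F : Measure ℝ}
    (hm : ∀ i, Measurable (Y i)) (hind : iIndepFun Y P) (hlaw : ∀ i, P.map (Y i) = F)
    (hF : IsNonnegLawWithMean F) {θ δ : ℝ} (hθ : θ < mean F) (hδ : 0 < δ) :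
    ∃ s > 0, ∃ c, ∀ x : ℝ,
      P.real {ω | ∃ n m : ℕ, ∑ j ∈ Finset.range m, Y (n + j) ω < θ * m - δ * (x + n)} ≤
        c * Real.exp (-(s * x)) := by
  obtain ⟨s, hs, c, h⟩ := exists_lower_deviation_bound hm hind hlaw hF hθ
  set q := Real.exp (-(s * δ)) with hq
  have hq1 : q < 1 := by
    rw [hq, Real.exp_lt_one_iff]; have := mul_pos hs hδ; linarith
  refine ⟨s * δ, by positivity, c * (1 - q)⁻¹, fun x => ?_⟩
  have hU : {ω | ∃ n m : ℕ, ∑ j ∈ Finset.range m, Y (n + j) ω < θ * m - δ * (x + n)} =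
      ⋃ n : ℕ, {ω | ∃ m : ℕ, ∑ j ∈ Finset.range m, Y (n + j) ω < θ * m - δ * (x + n)} := by
    ext; simp
  rw [hU]
  refine (measureReal_iUnion_le_tsum (u := fun n => c * Real.exp (-(s * δ * x)) * q ^ n)
    ((summable_geometric_of_lt_one (Real.exp_pos _).le hq1).mul_left _)
    fun n => (h n _).trans_eq ?_).trans_eq ?_
  · rw [hq, ← Real.exp_nat_mul, mul_assoc, ← Real.exp_add]
    congr 2
    ring
  · rw [tsum_mul_left, tsum_geometric_of_lt_one (Real.exp_pos _).le hq1]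
    ring

end LowerDeviation

/-! ### Pathwise estimates for the arrival counting process. -/

namespace FeedbackInput

section Arrivals

variable {Ω : Type*} {Q : FeedbackInput Ω} {ω : Ω} {s s' : ℝ}

lemma finite_arrivals {θ z : ℝ} (hθ : 0 < θ)
    (h : ∀ m : ℕ, θ * m - z ≤ ∑ j ∈ Finset.range m, Q.interarrival j ω) (s : ℝ) :
    {n : ℕ | 1 ≤ n ∧ ∑ j ∈ Finset.range n, Q.interarrival j ω ≤ s}.Finite := by
  refine (Set.finite_Iic ⌊(s + z) / θ⌋₊).subset fun n hn => Nat.le_floor ?_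
  rw [le_div_iff₀ hθ]
  have := h n
  linarith [hn.2]

/-- Monotone partial sums make the counted set an initial segment of the positive integers.
Finiteness matters because `Set.ncard` is `0` on infinite sets. -/
lemma le_arrivals_iff (hnn : ∀ j, 0 ≤ Q.interarrival j ω)
    (hfin : {n : ℕ | 1 ≤ n ∧ ∑ j ∈ Finset.range n, Q.interarrival j ω ≤ s}.Finite)
    {n : ℕ} (hn : 1 ≤ n) :
    n ≤ Q.arrivals s ω ↔ ∑ j ∈ Finset.range n, Q.interarrival j ω ≤ s := by
  have hmono : Monotone fun n => ∑ j ∈ Finset.range n, Q.interarrival j ω := fun i j hij =>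
    Finset.sum_le_sum_of_subset_of_nonneg (Finset.range_mono hij) fun k _ _ => hnn k
  constructor
  · intro h
    by_contra hcon
    have hsub : {n : ℕ | 1 ≤ n ∧ ∑ j ∈ Finset.range n, Q.interarrival j ω ≤ s} ⊆
        Set.Icc 1 (n - 1) := by
      intro m hm
      refine ⟨hm.1, ?_⟩
      by_contra hmn
      exact hcon ((hmono (show n ≤ m by omega)).trans hm.2)
    have h1 := Set.ncard_le_ncard hsub (Set.finite_Icc _ _)
    have h2 : (Set.Icc 1 (n - 1)).ncard = n - 1 := by
      rw [← Finset.coe_Icc, Set.ncard_coe_finset, Nat.card_Icc]; omega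
    have h3 : n ≤ n - 1 := h.trans (h1.trans_eq h2)
    omega
  · intro h
    have hsub : Set.Icc 1 n ⊆
        {n : ℕ | 1 ≤ n ∧ ∑ j ∈ Finset.range n, Q.interarrival j ω ≤ s} :=
      fun m hm => ⟨hm.1, (hmono hm.2).trans h⟩
    have h1 := Set.ncard_le_ncard hsub hfin
    rwa [← Finset.coe_Icc, Set.ncard_coe_finset, Nat.card_Icc, Nat.add_sub_cancel] at h1

lemma sum_arrivals_le (hnn : ∀ j, 0 ≤ Q.interarrival j ω)
    (hfin : {n : ℕ | 1 ≤ n ∧ ∑ j ∈ Finset.range n, Q.interarrival j ω ≤ s}.Finite)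
    (hs : 0 ≤ s) : ∑ j ∈ Finset.range (Q.arrivals s ω), Q.interarrival j ω ≤ s := by
  rcases Nat.eq_zero_or_pos (Q.arrivals s ω) with h | h
  · simpa [h] using hs
  · exact (le_arrivals_iff hnn hfin h).1 le_rfl

lemma lt_sum_arrivals_succ (hnn : ∀ j, 0 ≤ Q.interarrival j ω)
    (hfin : {n : ℕ | 1 ≤ n ∧ ∑ j ∈ Finset.range n, Q.interarrival j ω ≤ s}.Finite) :
    s < ∑ j ∈ Finset.range (Q.arrivals s ω + 1), Q.interarrival j ω := by
  by_contra h
  have := (le_arrivals_iff hnn hfin (Nat.succ_pos _)).2 (not_lt.1 h)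
  omega

lemma arrivals_mono (hfin : {n : ℕ | 1 ≤ n ∧ ∑ j ∈ Finset.range n, Q.interarrival j ω ≤ s'}.Finite)
    (h : s ≤ s') : Q.arrivals s ω ≤ Q.arrivals s' ω :=
  Set.ncard_le_ncard (fun _ hn => ⟨hn.1, hn.2.trans h⟩) hfin

lemma arrivals_le {θ z : ℝ} (hθ : 0 < θ) (hnn : ∀ j, 0 ≤ Q.interarrival j ω)
    (h : ∀ m : ℕ, θ * m - z ≤ ∑ j ∈ Finset.range m, Q.interarrival j ω) (hs : 0 ≤ s) :
    (Q.arrivals s ω : ℝ) ≤ (s + z) / θ := by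
  rw [le_div_iff₀ hθ]
  have h1 := sum_arrivals_le hnn (finite_arrivals hθ h s) hs
  linarith [h (Q.arrivals s ω)]

/-- The arrival with index `N(s) + 1` is the first after `s`; it accounts for the `1`. The later
arrivals up to `s'` fit into `s' - s`, so the hypothesis applies to the sums started at that index.
-/
lemma arrivals_sub_le {θ δ x : ℝ} (hθ : 0 < θ) (hδ : 0 ≤ δ) (hx : 0 ≤ x)
    (hnn : ∀ j, 0 ≤ Q.interarrival j ω)
    (h : ∀ n m : ℕ, θ * m - δ * (x + n) ≤ ∑ j ∈ Finset.range m, Q.interarrival (n + j) ω)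
    (hs : 0 ≤ s) (hss : s ≤ s') :
    ((Q.arrivals s' ω - Q.arrivals s ω : ℕ) : ℝ) ≤
      1 + (s' - s + δ * (x + (Q.arrivals s ω + 1))) / θ := by
  have h0 : ∀ m : ℕ, θ * m - δ * x ≤ ∑ j ∈ Finset.range m, Q.interarrival j ω := by
    intro m; simpa using h 0 m
  have hfin := finite_arrivals hθ h0
  have hR : 0 ≤ (s' - s + δ * (x + (Q.arrivals s ω + 1))) / θ := by
    have : 0 ≤ s' - s := by linarith
    positivity
  rcases le_or_gt (Q.arrivals s' ω) (Q.arrivals s ω) with hle | hlt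
  · rw [Nat.sub_eq_zero_of_le hle]; push_cast; linarith
  obtain ⟨m, hm⟩ := Nat.exists_eq_add_of_lt hlt
  have h1 := lt_sum_arrivals_succ hnn (hfin s)
  have h2 := sum_arrivals_le hnn (hfin s') (hs.trans hss)
  rw [show Q.arrivals s' ω = (Q.arrivals s ω + 1) + m by omega, Finset.sum_range_add] at h2
  have h3 := h (Q.arrivals s ω + 1) m
  rw [show Q.arrivals s' ω - Q.arrivals s ω = 1 + m by omega]
  push_cast at h3 ⊢
  gcongr
  rw [le_div_iff₀ hθ]
  linarith

/-- Inversion of the law of large numbers: `s` lies between the partial sums of orders `N` and `N +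
1`, and `ε ≤ a / 2` gives the a priori bound on `N` needed to control `ε * N`. -/
lemma abs_arrivals_sub_le {a ε C : ℝ} (ha : 0 < a) (hε : 0 ≤ ε) (hεa : ε ≤ a / 2) (hC : a ≤ C)
    (hnn : ∀ j, 0 ≤ Q.interarrival j ω)
    (h : ∀ n : ℕ, |∑ j ∈ Finset.range n, Q.interarrival j ω - n * a| ≤ ε * n + C)
    (hs : 0 ≤ s) : |a * Q.arrivals s ω - s| ≤ 2 / a * (ε * s) + 4 * C := by
  have h0 : ∀ m : ℕ, a / 2 * m - C ≤ ∑ j ∈ Finset.range m, Q.interarrival j ω := by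
    intro m
    have h1 := (abs_le.1 (h m)).1
    have h2 : ε * m ≤ a / 2 * m := by gcongr
    linarith
  have hfin := finite_arrivals (half_pos ha) h0 s
  have hN := arrivals_le (half_pos ha) hnn h0 hs
  set N := Q.arrivals s ω
  have h1 := (abs_le.1 (h N)).1
  have h2 := sum_arrivals_le hnn hfin hs
  have h3 := (abs_le.1 (h (N + 1))).2
  have h4 := lt_sum_arrivals_succ hnn hfin
  have h5 : ε * N ≤ 2 / a * (ε * s) + C := by
    calc ε * N ≤ ε * ((s + C) / (a / 2)) := by gcongr
      _ = 2 / a * (ε * s) + ε * C * (2 / a) := by field_simp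
      _ ≤ 2 / a * (ε * s) + a / 2 * C * (2 / a) := by
        have : 0 ≤ C := by linarith
        gcongr
      _ = _ := by field_simp
  push_cast at h3
  rw [abs_le]
  constructor <;> linarith

end Arrivals

end FeedbackInput

/-- The last stage of the queue that may be influenced by a primitive random variable is not
before its level; external variables have level `0`. -/
def Source.level : Source → ℕ
  | .interarrival _ => 0
  | .service k _ => k
  | .returns k _ => k
  | .first => 0

/-! ### Measurability of the recursion and independence of its ingredients. -/

namespace FeedbackInput

section Measurability

variable {Ω : Type*} {Q : FeedbackInput Ω}

lemma X_zero (ω : Ω) : Q.X 0 ω = 0 := rfl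

lemma T_zero (ω : Ω) : Q.T 0 ω = 0 := rfl

lemma T_succ (k : ℕ) (ω : Ω) : Q.T (k + 1) ω = Q.T k ω + Q.stage (k + 1) (Q.X k ω) ω := rfl

lemma X_succ (k : ℕ) (ω : Ω) : Q.X (k + 1) ω =
    Q.arrivals (Q.T (k + 1) ω) ω - Q.arrivals (Q.T k ω) ω + Q.numReturns (k + 1) (Q.X k ω) ω :=
  rfl

lemma T_one (ω : Ω) : Q.T 1 ω = Q.first ω := by
  simp [T_succ, T_zero, stage]

lemma stage_of_ne_one {k : ℕ} (hk : k ≠ 1) (x : ℕ) (ω : Ω) :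
    Q.stage k x ω = ∑ i ∈ Finset.range (x + 1), Q.service k i ω := if_neg hk

lemma numReturns_eq_sum_range (k x : ℕ) (ω : Ω) :
    (Q.numReturns k x ω : ℝ) = ∑ j ∈ Finset.range x, Q.var (.returns k (j + 1)) ω := by
  unfold numReturns
  have : Finset.Icc 1 x = Finset.Ico (0 + 1) (x + 1) := by ext; simp
  rw [this, ← Finset.sum_Ico_add' (fun i => if Q.returns k i ω then 1 else 0) 0 x 1,
    Finset.range_eq_Ico]
  push_cast
  rfl

lemma numReturns_le (k x : ℕ) (ω : Ω) : Q.numReturns k x ω ≤ x := by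
  unfold numReturns
  calc _ ≤ ∑ i ∈ Finset.Icc 1 x, 1 := Finset.sum_le_sum fun i _ => by split_ifs <;> simp
    _ = x := by simp

lemma stage_nonneg (hf : 0 ≤ Q.first ω) (hs : ∀ k i, 0 ≤ Q.service k i ω) (k x : ℕ) :
    0 ≤ Q.stage k x ω := by
  unfold stage
  split_ifs
  · exact hf
  · exact Finset.sum_nonneg fun i _ => hs k i

lemma T_nonneg (hf : 0 ≤ Q.first ω) (hs : ∀ k i, 0 ≤ Q.service k i ω) (k : ℕ) :
    0 ≤ Q.T k ω := by
  induction k with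
  | zero => exact le_rfl
  | succ k ih => rw [T_succ]; exact add_nonneg ih (stage_nonneg hf hs _ _)

variable {m : MeasurableSpace Ω}

lemma measurable_arrivals (hA : ∀ n, Measurable (Q.interarrival n)) {τ : Ω → ℝ}
    (hτ : Measurable τ) : Measurable fun ω => Q.arrivals (τ ω) ω := by
  refine measurable_ncard.comp (measurable_set_iff.2 fun n => ?_)
  have h1 : Measurable fun ω => ∑ j ∈ Finset.range n, Q.interarrival j ω :=
    Finset.measurable_fun_sum _ fun j _ => hA j
  exact measurable_const.and (measurableSet_setOfPred.1 (measurableSet_le h1 hτ))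

lemma measurable_stage {k : ℕ} (hF : Measurable Q.first) (hS : ∀ i, Measurable (Q.service k i))
    {N : Ω → ℕ} (hN : Measurable N) : Measurable fun ω => Q.stage k (N ω) ω := by
  have h1 : Measurable fun q : ℕ × Ω => Q.stage k q.1 q.2 := by
    refine measurable_from_prod_countable_right fun n => ?_
    unfold stage
    split_ifs
    · exact hF
    · exact Finset.measurable_fun_sum (Finset.range (n + 1)) fun j _ => hS j
  exact h1.comp (hN.prodMk measurable_id)

lemma measurable_returns {k i : ℕ} (h : Measurable (Q.var (.returns k i))) :
    Measurable (Q.returns k i) := by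
  have h1 : MeasurableSet {ω | Q.returns k i ω = true} := by
    have : {ω | Q.returns k i ω = true} = Q.var (.returns k i) ⁻¹' {1} := by
      ext ω; simp [var]
    rw [this]
    exact h (measurableSet_singleton _)
  exact measurable_to_bool h1

lemma measurable_numReturns {k : ℕ} (hR : ∀ i, Measurable (Q.var (.returns k i)))
    {N : Ω → ℕ} (hN : Measurable N) : Measurable fun ω => Q.numReturns k (N ω) ω := by
  have h1 : Measurable fun q : ℕ × Ω => Q.numReturns k q.1 q.2 := by
    refine measurable_from_prod_countable_right fun n => ?_
    unfold numReturns
    exact Finset.measurable_fun_sum (Finset.Icc 1 n) fun j _ =>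
      (measurable_from_top (f := fun b : Bool => if b then (1 : ℕ) else 0)).comp
        (measurable_returns (hR j))
  exact h1.comp (hN.prodMk measurable_id)

/-- The σ-algebra is arbitrary, so that it can be taken generated by part of the primitive
variables; independence of the remaining ones then follows. -/
lemma measurable_X_T {k : ℕ} (h : ∀ s : Source, s.level ≤ k → Measurable (Q.var s)) :
    Measurable (Q.X k) ∧ Measurable (Q.T k) := by
  induction k with
  | zero => exact ⟨measurable_const, measurable_const⟩
  | succ k ih =>
    obtain ⟨hX, hT⟩ := ih fun s hs => h s (hs.trans k.le_succ)
    have hA : ∀ n, Measurable (Q.interarrival n) := fun n =>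
      h (.interarrival n) (Nat.zero_le _)
    have hT' : Measurable (Q.T (k + 1)) :=
      hT.add (measurable_stage (h .first (Nat.zero_le _)) (fun i => h (.service (k + 1) i) le_rfl)
        hX)
    refine ⟨?_, hT'⟩
    have hR := measurable_numReturns (k := k + 1) (fun i => h (.returns (k + 1) i) le_rfl) hX
    have hd : Measurable fun ω =>
        (Q.arrivals (Q.T (k + 1) ω) ω, Q.arrivals (Q.T k ω) ω) :=
      (measurable_arrivals hA hT').prodMk (measurable_arrivals hA hT)
    exact ((Measurable.of_discrete (f := fun q : ℕ × ℕ => q.1 - q.2)).comp hd).add hR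

end Measurability

section Independence

variable {Ω : Type*} {Q : FeedbackInput Ω}

/-- The σ-algebra generated by the primitive variables with labels in a set. -/
abbrev varSigma (Q : FeedbackInput Ω) (S : Set Source) : MeasurableSpace Ω :=
  ⨆ s ∈ S, MeasurableSpace.comap (Q.var s) inferInstance

lemma measurable_var_varSigma {S : Set Source} {s : Source} (hs : s ∈ S) :
    Measurable[Q.varSigma S] (Q.var s) :=
  Measurable.mono (comap_measurable (Q.var s))
    (le_iSup₂ (f := fun s (_ : s ∈ S) => MeasurableSpace.comap (Q.var s) inferInstance) s hs) le_rfl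

variable [mΩ : MeasurableSpace Ω] {P : Measure Ω} [IsProbabilityMeasure P]
  {A G H : Measure ℝ} {p : ℝ}

omit [IsProbabilityMeasure P] in
lemma IsGIGI1.varSigma_le (hQ : Q.IsGIGI1 P A G H p) (S : Set Source) : Q.varSigma S ≤ mΩ :=
  iSup₂_le fun s _ => (hQ.measurable_var s).comap_le

omit [IsProbabilityMeasure P] in
lemma IsGIGI1.indep_varSigma (hQ : Q.IsGIGI1 P A G H p) {S S' : Set Source}
    (h : Disjoint S S') : Indep (Q.varSigma S) (Q.varSigma S') P :=
  indep_iSup_of_disjoint (fun s => (hQ.measurable_var s).comap_le)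
    ((iIndepFun_iff_iIndep _ _ _).1 hQ.indep) h

omit [IsProbabilityMeasure P] in
lemma IsGIGI1.indep_interarrival (hQ : Q.IsGIGI1 P A G H p) : iIndepFun Q.interarrival P :=
  hQ.indep.precomp (g := Source.interarrival) fun _ _ h => by injection h

omit [IsProbabilityMeasure P] in
lemma IsGIGI1.indep_service (hQ : Q.IsGIGI1 P A G H p) (k : ℕ) : iIndepFun (Q.service k) P :=
  hQ.indep.precomp (g := Source.service k) fun _ _ h => by injection h

omit [IsProbabilityMeasure P] in
lemma IsGIGI1.indep_returns (hQ : Q.IsGIGI1 P A G H p) (k : ℕ) :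
    iIndepFun (fun j => Q.var (.returns k (j + 1))) P :=
  hQ.indep.precomp (g := fun j => Source.returns k (j + 1)) fun _ _ h => by
    injection h with _ h; exact Nat.succ_injective h

omit [IsProbabilityMeasure P] in
lemma IsGIGI1.ae_nonneg (hQ : Q.IsGIGI1 P A G H p) (hA : IsNonnegLawWithMean A)
    (hG : IsNonnegLawWithMean G) (hH : IsNonnegLawWithMean H) :
    ∀ᵐ ω ∂P, (∀ n, 0 ≤ Q.interarrival n ω) ∧ (∀ k i, 0 ≤ Q.service k i ω) ∧ 0 ≤ Q.first ω := by
  have h : ∀ {F : Measure ℝ} {Y : Ω → ℝ}, IsNonnegLawWithMean F → Measurable Y → P.map Y = F →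
      ∀ᵐ ω ∂P, 0 ≤ Y ω := fun hF hY hlaw =>
    ae_of_ae_map hY.aemeasurable (by rw [hlaw]; exact hF.nonneg)
  refine (ae_all_iff.2 fun n => h hA (hQ.measurable_var (.interarrival n))
    (hQ.law_interarrival n)).and ((ae_all_iff.2 fun k => ae_all_iff.2 fun i =>
      h hG (hQ.measurable_var (.service k i)) (hQ.law_service k i)).and
      (h hH (hQ.measurable_var .first) hQ.law_first))

lemma IsGIGI1.map_returns (hQ : Q.IsGIGI1 P A G H p) (k i k' i' : ℕ) :
    P.map (Q.returns k i) = P.map (Q.returns k' i') := by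
  have hm := fun k i => measurable_returns (hQ.measurable_var (.returns k i))
  have ht : P {ω | Q.returns k i ω = true} = P {ω | Q.returns k' i' ω = true} := by
    rw [← ENNReal.toReal_eq_toReal_iff' (measure_ne_top _ _) (measure_ne_top _ _)]
    exact (hQ.law_returns k i).trans (hQ.law_returns k' i').symm
  have hc : ∀ k i, MeasurableSet {ω | Q.returns k i ω = true} := fun k i =>
    hm k i (measurableSet_singleton true)
  refine Measure.ext_of_singleton fun b => ?_
  rw [Measure.map_apply (hm k i) (measurableSet_singleton b),
    Measure.map_apply (hm k' i') (measurableSet_singleton b)]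
  cases b
  · have he : ∀ k i, Q.returns k i ⁻¹' {false} = {ω | Q.returns k i ω = true}ᶜ := by
      intro k i; ext ω; simp
    rw [he, he, prob_compl_eq_one_sub (hc k i), prob_compl_eq_one_sub (hc k' i'), ht]
  · exact ht

lemma IsGIGI1.map_comp_returns (hQ : Q.IsGIGI1 P A G H p) (g : ℝ → ℝ)
    (k i k' i' : ℕ) :
    P.map (fun ω => g (Q.var (.returns k i) ω)) = P.map (fun ω => g (Q.var (.returns k' i') ω)) := by
  have h : ∀ k i, P.map (fun ω => g (Q.var (.returns k i) ω)) =
      (P.map (Q.returns k i)).map fun b : Bool => g (if b then 1 else 0) := fun k i => by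
    rw [Measure.map_map measurable_from_top (measurable_returns (hQ.measurable_var _))]; rfl
  rw [h, h, hQ.map_returns k i k' i']

lemma IsGIGI1.integral_returns (hQ : Q.IsGIGI1 P A G H p) (k i : ℕ) :
    Integrable (Q.var (.returns k i)) P ∧ ∫ ω, Q.var (.returns k i) ω ∂P = p := by
  have hc : MeasurableSet {ω | Q.returns k i ω = true} :=
    measurable_returns (hQ.measurable_var (.returns k i)) (measurableSet_singleton true)
  have he : Q.var (.returns k i) = {ω | Q.returns k i ω = true}.indicator 1 := by
    ext ω; simp [var, Set.indicator_apply]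
  rw [he]
  exact ⟨(integrable_const (1 : ℝ)).indicator hc,
    (integral_indicator_one hc).trans (hQ.law_returns k i)⟩

end Independence

end FeedbackInput

/-! ### The upper bound. -/

lemma IsNonnegLawWithMean.mean_pos {G : Measure ℝ} (hG : IsNonnegLawWithMean G)
    (h : 0 < tail G 0) : 0 < mean G := by
  refine lt_of_le_of_ne hG.mean_nonneg fun h0 => ?_
  have h1 := (integral_eq_zero_iff_of_nonneg_ae hG.nonneg hG.integrable).1 h0.symm
  have h2 : G (Set.Ioi 0) = 0 :=
    measure_mono_null (fun y (hy : 0 < y) => show ¬ y = 0 from hy.ne') (ae_iff.1 h1)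
  rw [tail, Measure.real, h2] at h
  simp at h

/-- The coefficients by which a large number is multiplied can be perturbed slightly. -/
lemma exists_perturbation {a b p β ρ : ℝ} (ha : 0 < a) (hb : 0 < b) (hp : 0 < p) (hβ : 0 ≤ β)
    (hρ1 : ρ < 1) :
    ∃ δ > 0, δ < a ∧ ρ * (1 + β * δ / (a - δ) ^ 2) ≤ 1 ∧ ρ * (1 + β / (a - δ)) ≤ 1 + 1 / a * β ∧
      ρ * (β * (p + δ) + (1 + β / (a - δ)) * (b + δ)) ≤ b + (p + 1 / a * b) * β ∧
      β * (δ + (δ + δ * (δ / (a - δ) + δ)) / (a - δ) + δ) ≤ 1 - ρ := by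
  have ha' : a - 0 ≠ 0 := by simpa using ha.ne'
  have ha2 : (a - 0) ^ 2 ≠ 0 := pow_ne_zero 2 ha'
  have hc : ContinuousAt (fun δ : ℝ => a - δ) 0 := by fun_prop
  -- All four inequalities are strict at `δ = 0` because `ρ < 1`, and persist nearby by continuity.
  have h1 : ∀ᶠ δ in 𝓝 (0 : ℝ), ρ * (1 + β * δ / (a - δ) ^ 2) < 1 := by
    have : ContinuousAt (fun δ : ℝ => ρ * (1 + β * δ / (a - δ) ^ 2)) 0 := by
      fun_prop (disch := assumption)
    exact this.eventually_lt_const (by simpa using hρ1)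
  have h2 : ∀ᶠ δ in 𝓝 (0 : ℝ), ρ * (1 + β / (a - δ)) < 1 + 1 / a * β := by
    have : ContinuousAt (fun δ : ℝ => ρ * (1 + β / (a - δ))) 0 := by
      fun_prop (disch := assumption)
    refine this.eventually_lt_const ?_
    have h : 0 < 1 + 1 / a * β := by positivity
    calc ρ * (1 + β / (a - 0)) = ρ * (1 + 1 / a * β) := by rw [sub_zero]; ring
      _ < 1 + 1 / a * β := mul_lt_of_lt_one_left h hρ1
  have h3 : ∀ᶠ δ in 𝓝 (0 : ℝ), ρ * (β * (p + δ) + (1 + β / (a - δ)) * (b + δ)) <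
      b + (p + 1 / a * b) * β := by
    have : ContinuousAt
        (fun δ : ℝ => ρ * (β * (p + δ) + (1 + β / (a - δ)) * (b + δ))) 0 := by
      fun_prop (disch := assumption)
    refine this.eventually_lt_const ?_
    have h : 0 < b + (p + 1 / a * b) * β := by positivity
    calc ρ * (β * (p + 0) + (1 + β / (a - 0)) * (b + 0)) = ρ * (b + (p + 1 / a * b) * β) := by
          rw [sub_zero]; ring
      _ < _ := mul_lt_of_lt_one_left h hρ1
  have h4 : ∀ᶠ δ in 𝓝 (0 : ℝ),
      β * (δ + (δ + δ * (δ / (a - δ) + δ)) / (a - δ) + δ) < 1 - ρ := by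
    have : ContinuousAt
        (fun δ : ℝ => β * (δ + (δ + δ * (δ / (a - δ) + δ)) / (a - δ) + δ)) 0 := by
      fun_prop (disch := assumption)
    exact this.eventually_lt_const (by simp; linarith)
  have h5 := (((h1.and h2).and (h3.and h4)).and (gt_mem_nhds ha)).filter_mono
    (nhdsWithin_le_nhds (s := Set.Ioi 0))
  obtain ⟨δ, ⟨⟨⟨q1, q2⟩, q3, q4⟩, q5⟩, hδ⟩ := (h5.and self_mem_nhdsWithin).exists
  exact ⟨δ, hδ, q5, q1.le, q2.le, q3.le, q4.le⟩

/-- The sum over the possible locations of the big jump; `k` counts the completed services after the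
first, and `w j` is the weight of the `j`-th stage. -/
noncomputable def jumpBound (G H : Measure ℝ) (rate b p : ℝ) (w : ℕ → ℝ) : ℕ → ℝ → ℝ → ℝ
  | 0, β, x => tail H (x / (1 + rate * β))
  | k + 1, β, x => jumpBound G H rate b p w k (b + (p + rate * b) * β) x +
      w (k + 1) * tail G (x / (1 + rate * β))

lemma jumpBound_eq_sum (G H : Measure ℝ) (rate b p : ℝ) (w : ℕ → ℝ) (k : ℕ) (β x : ℝ) :
    jumpBound G H rate b p w k β x =
      ∑ l ∈ Finset.range k, w (k - l) *
        tail G (x / (1 + rate * (fun t => b + (p + rate * b) * t)^[l] β)) +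
      tail H (x / (1 + rate * (fun t => b + (p + rate * b) * t)^[k] β)) := by
  induction k generalizing β with
  | zero => simp [jumpBound]
  | succ k ih =>
    rw [jumpBound, ih, Finset.sum_range_succ']
    simp only [Function.iterate_succ_apply, Nat.add_sub_add_right, Function.iterate_zero, id,
      Nat.sub_zero]
    ring

namespace FeedbackInput

variable {Ω : Type*} {Q : FeedbackInput Ω} [mΩ : MeasurableSpace Ω] {P : Measure Ω}
  [IsProbabilityMeasure P] {A G H : Measure ℝ} {p : ℝ}

/-- Too many returns means too few departures, and departure indicators are nonnegative with mean `1
- p`. -/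
lemma IsGIGI1.exists_returns_bound (hQ : Q.IsGIGI1 P A G H p) (k : ℕ) {δ : ℝ} (hδ : 0 < δ) :
    ∃ s > 0, ∃ c, ∀ x : ℝ,
      P.real {ω | ∃ n : ℕ, (p + δ) * n + δ * x < Q.numReturns k n ω} ≤
        c * Real.exp (-(s * x)) := by
  set Y : ℕ → Ω → ℝ := fun j ω => 1 - Q.var (.returns k (j + 1)) ω with hY
  have hm : ∀ j, Measurable (Y j) := fun j => measurable_const.sub (hQ.measurable_var _)
  have hind : iIndepFun Y P := (hQ.indep_returns k).comp (fun _ y => 1 - y)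
    (fun _ => measurable_const.sub measurable_id)
  have hlaw : ∀ j, P.map (Y j) = P.map (Y 0) := fun j =>
    hQ.map_comp_returns (fun y => 1 - y) k (j + 1) k (0 + 1)
  have hYi : Integrable (Y 0) P := (integrable_const _).sub (hQ.integral_returns k (0 + 1)).1
  have hF : IsNonnegLawWithMean (P.map (Y 0)) := by
    refine ⟨Measure.isProbabilityMeasure_map (hm 0).aemeasurable, ?_, ?_⟩
    · refine (ae_map_iff (hm 0).aemeasurable measurableSet_Ici).2 (Eventually.of_forall fun ω => ?_)
      simp only [hY, var]
      split_ifs <;> simp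
    · exact (integrable_map_measure measurable_id.aestronglyMeasurable (hm 0).aemeasurable).2 hYi
  have hmean : mean (P.map (Y 0)) = 1 - p := by
    rw [mean, integral_map (f := fun y : ℝ => y) (hm 0).aemeasurable
      measurable_id.aestronglyMeasurable]
    simp only [hY]
    rw [integral_sub (integrable_const _) (hQ.integral_returns k (0 + 1)).1,
      (hQ.integral_returns k (0 + 1)).2]
    simp
  obtain ⟨s, hs, c, h⟩ := exists_lower_deviation_bound hm hind hlaw hF (θ := 1 - p - δ)
    (by rw [hmean]; linarith)
  refine ⟨s * δ, by positivity, c, fun x => ?_⟩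
  have h1 := h 0 (δ * x)
  rw [← mul_assoc] at h1
  refine (measureReal_mono ?_ (measure_ne_top _ _)).trans h1
  rintro ω ⟨n, hn⟩
  refine ⟨n, ?_⟩
  rw [numReturns_eq_sum_range] at hn
  simp only [hY, zero_add, Finset.sum_sub_distrib, Finset.sum_const, Finset.card_range,
    nsmul_eq_mul, mul_one]
  linarith

omit mΩ in
-- A stage of length `U` brings about `U / θ` arrivals, whence the factor `1 + β / θ`. The
-- coefficient `β * δ / θ ^ 2` of `T_k` comes from the allowance `δ` per earlier arrival, of which
-- there are about `T_k / θ`.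
lemma T_add_mul_X_succ_le {ω : Ω} {k : ℕ} {θ δ x β : ℝ} (hθ : 0 < θ) (hδ : 0 ≤ δ) (hx : 0 ≤ x)
    (hβ : 0 ≤ β) (hnn : ∀ j, 0 ≤ Q.interarrival j ω) (hS : ∀ k i, 0 ≤ Q.service k i ω)
    (hf : 0 ≤ Q.first ω)
    (h : ∀ n m : ℕ, θ * m - δ * (x + n) ≤ ∑ j ∈ Finset.range m, Q.interarrival (n + j) ω)
    (hR : ∀ n : ℕ, (Q.numReturns (k + 1) n ω : ℝ) ≤ (p + δ) * n + δ * x) :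
    Q.T (k + 1) ω + β * Q.X (k + 1) ω ≤
      (1 + β * δ / θ ^ 2) * Q.T k ω + β * (p + δ) * Q.X k ω +
      (1 + β / θ) * Q.stage (k + 1) (Q.X k ω) ω +
      β * (1 + (δ * x + δ * (δ * x / θ + 1)) / θ + δ * x) := by
  have hT := T_nonneg hf hS k
  have hU := stage_nonneg hf hS (k + 1) (Q.X k ω)
  have h0 : ∀ m : ℕ, θ * m - δ * x ≤ ∑ j ∈ Finset.range m, Q.interarrival j ω := by
    intro m; simpa using h 0 m
  have h1 := arrivals_sub_le hθ hδ hx hnn h hT (s' := Q.T (k + 1) ω) (by rw [T_succ]; linarith)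
  have h2 := arrivals_le hθ hnn h0 hT
  have h3 := hR (Q.X k ω)
  have h4 : (Q.X (k + 1) ω : ℝ) ≤
      1 + (Q.stage (k + 1) (Q.X k ω) ω + δ * (x + ((Q.T k ω + δ * x) / θ + 1))) / θ +
        ((p + δ) * Q.X k ω + δ * x) := by
    rw [X_succ, Nat.cast_add]
    refine add_le_add (h1.trans ?_) h3
    rw [T_succ, add_sub_cancel_left]
    gcongr
  have h5 := mul_le_mul_of_nonneg_left h4 hβ
  rw [T_succ]
  refine (add_le_add le_rfl h5).trans_eq ?_
  field_simp
  ring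

/-- Outside an event of negligible probability, `T_{k+1} + β X_{k+1}` is bounded by a linear function
of the preceding stage. -/
lemma IsGIGI1.eventually_stage_le (hQ : Q.IsGIGI1 P A G H p) (hA : IsNonnegLawWithMean A)
    (hG : IsNonnegLawWithMean G) (hirv : IsIRV G) (hH : IsNonnegLawWithMean H) (k : ℕ)
    {δ β ρ ε : ℝ} (hδ : 0 < δ) (hδa : δ < mean A) (hβ : 0 ≤ β)
    (hρ : β * (δ + (δ + δ * (δ / (mean A - δ) + δ)) / (mean A - δ) + δ) ≤ 1 - ρ) (hε : 0 < ε) :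
    ∀ᶠ x in atTop,
      P.real {ω | x < Q.T (k + 1) ω + β * Q.X (k + 1) ω} ≤
        P.real {ω | ρ * x < (1 + β * δ / (mean A - δ) ^ 2) * Q.T k ω + β * (p + δ) * Q.X k ω +
          (1 + β / (mean A - δ)) * Q.stage (k + 1) (Q.X k ω) ω} + ε * tail G x := by
  have := hG.isProb
  set θ := mean A - δ with hθdef
  have hθ : 0 < θ := by rw [hθdef]; linarith
  obtain ⟨s₁, hs₁, c₁, hbad₁⟩ := exists_shifted_lower_deviation_bound
    (fun n => hQ.measurable_var (.interarrival n)) hQ.indep_interarrival hQ.law_interarrival hA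
    (θ := θ) (by linarith) hδ
  obtain ⟨s₂, hs₂, c₂, hbad₂⟩ := hQ.exists_returns_bound (k + 1) hδ
  have hexp : ∀ {s : ℝ} (c : ℝ), 0 < s → ∀ᶠ x in atTop,
      c * Real.exp (-(s * x)) ≤ ε / 2 * tail G x := by
    intro s c hs
    filter_upwards [((hirv.exp_isLittleO hs).const_mul_left c).def (half_pos hε)] with x hx
    rw [Real.norm_of_nonneg (tail_nonneg _ _)] at hx
    exact (le_abs_self _).trans hx
  filter_upwards [hexp c₁ hs₁, hexp c₂ hs₂, eventually_ge_atTop (1 / δ)] with x hx1 hx2 hx3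
  have hx0 : 0 < x := lt_of_lt_of_le (by positivity) hx3
  -- Lets the additive constants be absorbed into multiples of `x`.
  have hδx : 1 ≤ δ * x := by rwa [div_le_iff₀' hδ] at hx3
  have hnull := ae_iff.1 (hQ.ae_nonneg hA hG hH)
  set Z := {ω | ¬ ((∀ n, 0 ≤ Q.interarrival n ω) ∧ (∀ k i, 0 ≤ Q.service k i ω) ∧
    0 ≤ Q.first ω)} with hZ
  have hZ0 : P.real Z = 0 := by rw [Measure.real, hnull]; rfl
  set B₁ := {ω | ∃ n m : ℕ,
    ∑ j ∈ Finset.range m, Q.interarrival (n + j) ω < θ * m - δ * (x + n)} with hB₁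
  set B₂ := {ω | ∃ n : ℕ, (p + δ) * n + δ * x < Q.numReturns (k + 1) n ω} with hB₂
  set M := {ω | ρ * x < (1 + β * δ / θ ^ 2) * Q.T k ω + β * (p + δ) * Q.X k ω +
          (1 + β / θ) * Q.stage (k + 1) (Q.X k ω) ω} with hM
  have hsub : {ω | x < Q.T (k + 1) ω + β * Q.X (k + 1) ω} ⊆ (M ∪ Z) ∪ (B₁ ∪ B₂) := by
    intro ω hω
    by_contra hcon
    simp only [Set.mem_union, not_or] at hcon
    obtain ⟨⟨hM', hZ'⟩, hB1, hB2⟩ := hcon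
    simp only [hZ, Set.mem_ofPred_eq, not_not] at hZ'
    simp only [hB₁, hB₂, hM, Set.mem_ofPred_eq, not_exists, not_lt] at hM' hB1 hB2
    have h1 := T_add_mul_X_succ_le hθ hδ.le hx0.le hβ hZ'.1 hZ'.2.1 hZ'.2.2 hB1 hB2
    have h2 : β * (1 + (δ * x + δ * (δ * x / θ + 1)) / θ + δ * x) ≤ (1 - ρ) * x := by
      calc β * (1 + (δ * x + δ * (δ * x / θ + 1)) / θ + δ * x)
          ≤ β * (δ * x + (δ * x + δ * (δ * x / θ + δ * x)) / θ + δ * x) := by gcongr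
        _ = β * (δ + (δ + δ * (δ / θ + δ)) / θ + δ) * x := by field_simp
        _ ≤ _ := by gcongr
    have h3 : x < Q.T (k + 1) ω + β * Q.X (k + 1) ω := hω
    linarith
  have e1 := measureReal_mono hsub (measure_ne_top P _)
  have e2 := measureReal_union_le (μ := P) (M ∪ Z) (B₁ ∪ B₂)
  have e3 := measureReal_union_le (μ := P) M Z
  have e4 := measureReal_union_le (μ := P) B₁ B₂
  have e5 : P.real B₁ ≤ _ := hbad₁ x
  have e6 : P.real B₂ ≤ _ := hbad₂ x
  linarith

lemma IsGIGI1.eventually_tail_first_stage_le (hQ : Q.IsGIGI1 P A G H p)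
    (hA : IsNonnegLawWithMean A) (hA0 : 0 < mean A) (hG : IsNonnegLawWithMean G)
    (hirv : IsIRV G) (hH : IsNonnegLawWithMean H) (hp : 0 < p) {β ρ ε : ℝ} (hβ : 0 ≤ β)
    (hρ0 : 0 < ρ) (hρ1 : ρ < 1) (hε : 0 < ε) :
    ∀ᶠ x in atTop, P.real {ω | x < Q.T 1 ω + β * Q.X 1 ω} ≤
      tail H (ρ * x / (1 + 1 / mean A * β)) + ε * tail G x := by
  have := hH.isProb
  -- One factor `ρ₁` pays for the errors proportional to `x`, the other for the perturbed
  -- coefficient.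
  set ρ₁ := Real.sqrt ρ with hρ₁
  have hρ₁0 : 0 < ρ₁ := Real.sqrt_pos.2 hρ0
  have hρ₁1 : ρ₁ < 1 := by rw [hρ₁, Real.sqrt_lt' one_pos]; simpa using hρ1
  have hsq : ρ₁ * ρ₁ = ρ := Real.mul_self_sqrt hρ0.le
  obtain ⟨δ, hδ, hδa, h1, h2, h3, h4⟩ := exists_perturbation hA0
    (hG.mean_pos (hirv.tail_pos 0)) hp hβ hρ₁1
  filter_upwards [hQ.eventually_stage_le hA hG hirv hH 0 hδ hδa hβ h4 hε, eventually_ge_atTop 0]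
    with x hx hx0
  refine hx.trans (add_le_add ?_ le_rfl)
  have hγ : 0 < 1 + β / (mean A - δ) := by
    have : 0 < mean A - δ := by linarith
    positivity
  have hl : 0 < 1 + 1 / mean A * β := by positivity
  have he : {ω | ρ₁ * x < (1 + β * δ / (mean A - δ) ^ 2) * Q.T 0 ω + β * (p + δ) * Q.X 0 ω +
          (1 + β / (mean A - δ)) * Q.stage (0 + 1) (Q.X 0 ω) ω} =
      {ω | ρ₁ * x / (1 + β / (mean A - δ)) < Q.first ω} := by
    ext ω
    simp [T_zero, X_zero, stage, div_lt_iff₀' hγ]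
  rw [he, real_lt_eq_tail (Y := Q.first) (hQ.measurable_var .first) hQ.law_first]
  refine tail_antitone ?_
  rw [div_le_div_iff₀ hl hγ]
  calc ρ * x * (1 + β / (mean A - δ)) = ρ₁ * x * (ρ₁ * (1 + β / (mean A - δ))) := by
        rw [← hsq]; ring
    _ ≤ _ := by gcongr

omit [IsProbabilityMeasure P] in
lemma IsGIGI1.indep_state_service (hQ : Q.IsGIGI1 P A G H p) (k : ℕ) :
    Indep (Q.varSigma {s | s.level ≤ k}) (Q.varSigma (Set.range (Source.service (k + 1)))) P := by
  refine hQ.indep_varSigma (Set.disjoint_left.2 ?_)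
  rintro _ hs ⟨i, rfl⟩
  exact absurd (show k + 1 ≤ k from hs) (by omega)

/-- One step of the backward induction: the jump falls in the stage `k + 1`, or that stage is
replaced by its mean `b * X_k` and the weight of `X_k` becomes `b + rβ`. -/
lemma IsGIGI1.eventually_tail_succ_stage_le (hQ : Q.IsGIGI1 P A G H p)
    (hA : IsNonnegLawWithMean A) (hA0 : 0 < mean A) (hG : IsNonnegLawWithMean G)
    (hirv : IsIRV G) (hH : IsNonnegLawWithMean H) (hp : 0 < p) {k : ℕ} (hk : 1 ≤ k)
    (hX : Integrable (fun ω => (Q.X k ω : ℝ)) P) {β ρ ε : ℝ} (hβ : 0 ≤ β)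
    (hρ1 : ρ < 1) (hε : 0 < ε) :
    ∀ᶠ x in atTop, P.real {ω | x < Q.T (k + 1) ω + β * Q.X (k + 1) ω} ≤
      P.real {ω | ρ * x < Q.T k ω + (mean G + (p + 1 / mean A * mean G) * β) * Q.X k ω} +
      (∫ ω, (1 + (Q.X k ω : ℝ)) ∂P) * tail G (ρ * x / (1 + 1 / mean A * β)) + ε * tail G x := by
  have := hG.isProb
  -- Three losses occur: arrivals and returns, the random sum lemma, and the perturbed coefficients.
  obtain ⟨ρ₁, hρ₁0, hρ₁1, hpow⟩ : ∃ ρ₁ : ℝ, 0 < ρ₁ ∧ ρ₁ < 1 ∧ ρ ≤ ρ₁ ^ 3 := by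
    have h : Tendsto (fun y : ℝ => y ^ 3) (𝓝[<] 1) (𝓝 (1 ^ 3)) :=
      ((continuous_pow 3).tendsto 1).mono_left nhdsWithin_le_nhds
    have h' := h.eventually (lt_mem_nhds (show ρ < 1 ^ 3 by simpa using hρ1))
    obtain ⟨y, ⟨hy1, hy2⟩, hy3⟩ := ((h'.and (nhdsWithin_le_nhds
      (lt_mem_nhds (show (0 : ℝ) < 1 from one_pos)))).and self_mem_nhdsWithin).exists
    exact ⟨y, hy2, hy3, hy1.le⟩
  have hb := hG.mean_pos (hirv.tail_pos 0)
  obtain ⟨δ, hδ, hδa, h1, h2, h3, h4⟩ := exists_perturbation hA0 hb hp hβ hρ₁1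
  have hθ : 0 < mean A - δ := by linarith
  have hγ : 0 < 1 + β / (mean A - δ) := by positivity
  have hl : 0 < 1 + 1 / mean A * β := by positivity
  obtain ⟨C, hC, hCt⟩ := hirv.tail_mul_le hρ₁0
  set β' := mean G + (p + 1 / mean A * mean G) * β with hβ'
  obtain ⟨hXm, hTm⟩ := measurable_X_T (m := Q.varSigma {s | s.level ≤ k}) (Q := Q) (k := k)
    (fun s hs => measurable_var_varSigma hs)
  have hrs := eventually_random_sum_tail_le (hQ.varSigma_le _) (hQ.varSigma_le _)
    (hQ.indep_state_service k) (Y := Q.service (k + 1))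
    (fun i => measurable_var_varSigma (Q := Q) (s := .service (k + 1) i) ⟨i, rfl⟩) hXm
    (hTm.const_mul (1 + β * δ / (mean A - δ) ^ 2)) (hQ.indep_service (k + 1))
    (hQ.law_service (k + 1)) hX hG hirv (a := β * (p + δ)) hγ
    (show mean G < mean G + δ by linarith) hρ₁0 hρ₁1
    (show 0 < ε / (2 * C) by positivity)
  filter_upwards [hQ.eventually_stage_le hA hG hirv hH k hδ hδa hβ h4 (half_pos hε),
    (tendsto_id.const_mul_atTop hρ₁0).eventually hrs, eventually_ge_atTop 0] with x hx1 hx2 hx0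
  refine hx1.trans ?_
  simp only [stage_of_ne_one (show k + 1 ≠ 1 by omega)]
  simp only [id] at hx2
  have e1 : P.real {ω | ρ₁ * (ρ₁ * x) < (1 + β * δ / (mean A - δ) ^ 2) * Q.T k ω +
      (β * (p + δ) + (1 + β / (mean A - δ)) * (mean G + δ)) * Q.X k ω} ≤
      P.real {ω | ρ * x < Q.T k ω + β' * Q.X k ω} := by
    have hnull := ae_iff.1 (hQ.ae_nonneg hA hG hH)
    have hZ0 : P.real {ω | ¬ ((∀ n, 0 ≤ Q.interarrival n ω) ∧ (∀ k i, 0 ≤ Q.service k i ω) ∧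
      0 ≤ Q.first ω)} = 0 := by rw [Measure.real, hnull]; rfl
    rw [← add_zero (P.real {ω | ρ * x < Q.T k ω + β' * Q.X k ω}), ← hZ0]
    refine (measureReal_mono ?_ (measure_ne_top _ _)).trans (measureReal_union_le _ _)
    intro ω hω
    by_cases hn : (∀ n, 0 ≤ Q.interarrival n ω) ∧ (∀ k i, 0 ≤ Q.service k i ω) ∧ 0 ≤ Q.first ω
    · left
      have hT := T_nonneg hn.2.2 hn.2.1 k
      have hω' : ρ₁ * (ρ₁ * x) < (1 + β * δ / (mean A - δ) ^ 2) * Q.T k ω +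
        (β * (p + δ) + (1 + β / (mean A - δ)) * (mean G + δ)) * Q.X k ω := hω
      have hω2 := mul_lt_mul_of_pos_left hω' hρ₁0
      show ρ * x < Q.T k ω + β' * Q.X k ω
      calc ρ * x ≤ ρ₁ ^ 3 * x := by gcongr
        _ = ρ₁ * (ρ₁ * (ρ₁ * x)) := by ring
        _ < _ := hω2
        _ = (ρ₁ * (1 + β * δ / (mean A - δ) ^ 2)) * Q.T k ω +
          (ρ₁ * (β * (p + δ) + (1 + β / (mean A - δ)) * (mean G + δ))) * Q.X k ω := by ring
        _ ≤ 1 * Q.T k ω + β' * Q.X k ω := by gcongr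
        _ = _ := by rw [one_mul]
    · right; exact hn
  have e2 : tail G (ρ₁ * (ρ₁ * x) / (1 + β / (mean A - δ))) ≤
      tail G (ρ * x / (1 + 1 / mean A * β)) := by
    refine tail_antitone ?_
    rw [div_le_div_iff₀ hl hγ]
    calc ρ * x * (1 + β / (mean A - δ)) ≤ ρ₁ ^ 3 * x * (1 + β / (mean A - δ)) := by gcongr
      _ = ρ₁ * (ρ₁ * x) * (ρ₁ * (1 + β / (mean A - δ))) := by ring
      _ ≤ _ := by gcongr
  have e3 : ε / (2 * C) * tail G (ρ₁ * x) ≤ ε / 2 * tail G x := by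
    calc _ ≤ ε / (2 * C) * (C * tail G x) := by gcongr; exact hCt x hx0
      _ = _ := by field_simp
  have e4 : 0 ≤ ∫ ω, (1 + (Q.X k ω : ℝ)) ∂P := integral_nonneg fun ω => by positivity
  have e5 := mul_le_mul_of_nonneg_left e2 e4
  linarith

/-- The upper half of the tail asymptotics. -/
lemma IsGIGI1.eventually_tail_le_jumpBound (hQ : Q.IsGIGI1 P A G H p)
    (hA : IsNonnegLawWithMean A) (hA0 : 0 < mean A) (hG : IsNonnegLawWithMean G)
    (hirv : IsIRV G) (hH : IsNonnegLawWithMean H) (hp : 0 < p)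
    (hX : ∀ k, Integrable (fun ω => (Q.X k ω : ℝ)) P) (k : ℕ) {β ρ ε : ℝ} (hβ : 0 ≤ β)
    (hρ0 : 0 < ρ) (hρ1 : ρ < 1) (hε : 0 < ε) :
    ∀ᶠ x in atTop, P.real {ω | x < Q.T (k + 1) ω + β * Q.X (k + 1) ω} ≤
      jumpBound G H (1 / mean A) (mean G) p (fun j => ∫ ω, (1 + (Q.X j ω : ℝ)) ∂P) k β (ρ * x) +
        ε * tail G x := by
  have := hG.isProb
  have := hH.isProb
  induction k generalizing β ρ ε with
  | zero =>
    exact hQ.eventually_tail_first_stage_le hA hA0 hG hirv hH hp hβ hρ0 hρ1 hε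
  | succ k ih =>
    -- One factor for this stage, one for the induction hypothesis, which is applied at `ρ₁ * x`.
    set ρ₁ := Real.sqrt ρ with hρ₁
    have hρ₁0 : 0 < ρ₁ := Real.sqrt_pos.2 hρ0
    have hρ₁1 : ρ₁ < 1 := by rw [hρ₁, Real.sqrt_lt' one_pos]; simpa using hρ1
    have hsq : ρ₁ * ρ₁ = ρ := Real.mul_self_sqrt hρ0.le
    have hle : ρ ≤ ρ₁ := by rw [← hsq]; exact mul_le_of_le_one_left hρ₁0.le hρ₁1.le
    obtain ⟨C, hC, hCt⟩ := hirv.tail_mul_le hρ₁0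
    have hb := hG.mean_nonneg
    filter_upwards [hQ.eventually_tail_succ_stage_le hA hA0 hG hirv hH hp
      (Nat.succ_le_succ k.zero_le) (hX (k + 1)) hβ hρ₁1 (half_pos hε),
      (tendsto_id.const_mul_atTop hρ₁0).eventually
        (ih (β := mean G + (p + 1 / mean A * mean G) * β) (by positivity) hρ₁0 hρ₁1
          (show 0 < ε / (2 * C) by positivity)), eventually_ge_atTop 0] with x hx1 hx2 hx0
    simp only [id, ← mul_assoc, hsq] at hx2
    rw [jumpBound]
    have e3 : ε / (2 * C) * tail G (ρ₁ * x) ≤ ε / 2 * tail G x := by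
      calc _ ≤ ε / (2 * C) * (C * tail G x) := by gcongr; exact hCt x hx0
        _ = _ := by field_simp
    have e4 : 0 ≤ ∫ ω, (1 + (Q.X (k + 1) ω : ℝ)) ∂P := integral_nonneg fun ω => by positivity
    have e2 : tail G (ρ₁ * x / (1 + 1 / mean A * β)) ≤ tail G (ρ * x / (1 + 1 / mean A * β)) :=
      tail_antitone (by gcongr)
    have e5 := mul_le_mul_of_nonneg_left e2 e4
    linarith

end FeedbackInput

/-! ### The deterministic effect of one long stage. -/

lemma meanQueue_zero (rate b p : ℝ) : meanQueue rate b p 0 = 0 := by simp [meanQueue]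

lemma meanQueue_succ {rate b p : ℝ} (hr : p + rate * b ≠ 1) (k : ℕ) :
    meanQueue rate b p (k + 1) = meanQueue rate b p k + b * (rate * (p + rate * b) ^ k) := by
  have h : 1 - (p + rate * b) ≠ 0 := sub_ne_zero.2 hr.symm
  unfold meanQueue
  field_simp
  ring

lemma meanQueue_nonneg {rate b p : ℝ} (hrate : 0 ≤ rate) (hb : 0 ≤ b) (hp : 0 ≤ p)
    (hr : p + rate * b ≠ 1) (k : ℕ) : 0 ≤ meanQueue rate b p k := by
  induction k with
  | zero => rw [meanQueue_zero]
  | succ k ih => rw [meanQueue_succ hr]; positivity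

/-- Identifies the weights produced by the backward recursion `β ↦ b + rβ` with the `m_k`; both are
geometric sums. -/
lemma rate_mul_iterate_eq_meanQueue {rate b p : ℝ} (hr : p + rate * b ≠ 1) (k : ℕ) :
    rate * (fun t => b + (p + rate * b) * t)^[k] 0 = meanQueue rate b p k := by
  have h : 1 - (p + rate * b) ≠ 0 := sub_ne_zero.2 hr.symm
  have h1 : (fun t => b + (p + rate * b) * t)^[k] 0 =
      (1 - (p + rate * b) ^ k) / (1 - (p + rate * b)) * b := by
    induction k with
    | zero => simp
    | succ k ih => 
      rw [Function.iterate_succ_apply', ih]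
      generalize p + rate * b = r at h
      field_simp
      ring
  rw [h1, meanQueue]
  ring

/-- Propagation of errors through one stage of the queue. -/
lemma exists_stage_error_bound {a b p cT cX K : ℝ} (ha : 0 < a) (hb : 0 ≤ b) (hp : 0 ≤ p)
    (hcT : 0 ≤ cT) (hcX : 0 ≤ cX) (hK : 0 ≤ K) :
    ∃ K' ≥ 0, ∀ ε C Y t U x N N' B : ℝ, 0 ≤ ε → ε ≤ 1 → 1 ≤ C → 0 ≤ Y →
      |t - cT * Y| ≤ K * (ε * Y + C) → |x - cX * Y| ≤ K * (ε * Y + C) →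
      |U - (x + 1) * b| ≤ ε * (x + 1) + C → |B - x * p| ≤ ε * x + C →
      |a * N - t| ≤ 2 / a * (ε * t) + 4 * C →
      |a * N' - (t + U)| ≤ 2 / a * (ε * (t + U)) + 4 * C →
      |t + U - (cT + b * cX) * Y| ≤ K' * (ε * Y + C) ∧
      |N' - N + B - (p + 1 / a * b) * cX * Y| ≤ K' * (ε * Y + C) := by
  -- `K₁`, `K₂` and `K₃` bound the errors of `U`, of `t + U`, and of `a` times the new queue length,
  -- in units of `ε * Y + C`.
  set K₁ := b + cX + K + 2 + b * K with hK₁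
  set K₂ := K + K₁ with hK₂
  set K₃ := K₁ + 2 / a * (cT + K) + 2 / a * (cT + b * cX + K₂) + 8 + a * (cX + K + 1) + a * (p * K)
    with hK₃
  have hK₁0 : 0 ≤ K₁ := by positivity
  have hK₂0 : 0 ≤ K₂ := by positivity
  have hK₃0 : 0 ≤ K₃ := by positivity
  refine ⟨K₂ + K₃ / a, by positivity, ?_⟩
  intro ε C Y t U x N N' B hε hε1 hC hY ht hx hU hB hN hN'
  set D := ε * Y + C with hD
  have hεY : 0 ≤ ε * Y := by positivity
  have hCD : C ≤ D := by linarith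
  have hD1 : 1 ≤ D := by linarith
  have hD0 : 0 ≤ D := by linarith
  have hεD : ε * D ≤ D := mul_le_of_le_one_left hD0 hε1
  -- An error `ε * y` relative to a quantity near `c * Y` is again of order `ε * Y + C`, because `ε
  -- ≤ 1`.
  have hlin : ∀ {y c L : ℝ}, 0 ≤ c → 0 ≤ L → |y - c * Y| ≤ L * D → ε * y ≤ (c + L) * D := by
    intro y c L hc hL h
    have h1 : y ≤ c * Y + L * D := by have := (abs_le.1 h).2; linarith
    calc ε * y ≤ ε * (c * Y + L * D) := by gcongr
      _ = c * (ε * Y) + L * (ε * D) := by ring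
      _ ≤ c * D + L * D := by gcongr; linarith
      _ = _ := by ring
  have hεx := hlin hcX hK hx
  have hεt := hlin hcT hK ht
  have hU' : |U - b * cX * Y| ≤ K₁ * D := by
    have h1 : U - b * cX * Y = (U - (x + 1) * b) + (b * (x - cX * Y) + b) := by ring
    rw [h1]
    refine (abs_add_le _ _).trans ?_
    have h2 : |b * (x - cX * Y) + b| ≤ b * (K * D) + b := by
      refine (abs_add_le _ _).trans ?_
      rw [abs_mul, abs_of_nonneg hb]
      gcongr
    have h3 : b ≤ b * D := le_mul_of_one_le_right hb hD1
    rw [hK₁]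
    linarith
  have hT' : |t + U - (cT + b * cX) * Y| ≤ K₂ * D := by
    have h1 : t + U - (cT + b * cX) * Y = (t - cT * Y) + (U - b * cX * Y) := by ring
    rw [h1, hK₂, add_mul]
    exact (abs_add_le _ _).trans (add_le_add ht hU')
  have hεt' := hlin (by positivity) hK₂0 hT'
  have h2a : 0 ≤ 2 / a := by positivity
  have hX' : |a * (N' - N + B - (p + 1 / a * b) * cX * Y)| ≤ K₃ * D := by
    have h1 : a * (N' - N + B - (p + 1 / a * b) * cX * Y) =
        (a * N' - (t + U)) - (a * N - t) + (U - b * cX * Y) +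
          (a * (B - x * p) + a * (p * (x - cX * Y))) := by
      field_simp; ring
    have h2 : |a * (B - x * p) + a * (p * (x - cX * Y))| ≤
        a * ((cX + K + 1) * D) + a * (p * (K * D)) := by
      refine (abs_add_le _ _).trans ?_
      rw [abs_mul, abs_mul, abs_mul, abs_of_pos ha, abs_of_nonneg hp]
      gcongr
      linarith
    have h3 := mul_le_mul_of_nonneg_left hεt h2a
    have h4 := mul_le_mul_of_nonneg_left hεt' h2a
    rw [h1, hK₃]
    have h5 := abs_add_le ((a * N' - (t + U)) - (a * N - t) + (U - b * cX * Y))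
      (a * (B - x * p) + a * (p * (x - cX * Y)))
    have h6 := abs_add_le ((a * N' - (t + U)) - (a * N - t)) (U - b * cX * Y)
    have h7 := abs_sub (a * N' - (t + U)) (a * N - t)
    linarith
  have hK3a : 0 ≤ K₃ / a * D := by positivity
  constructor
  · linarith
  · rw [abs_mul, abs_of_pos ha] at hX'
    have h1 : |N' - N + B - (p + 1 / a * b) * cX * Y| ≤ K₃ / a * D := by
      rw [show K₃ / a * D = K₃ * D / a by ring, le_div_iff₀ ha]
      linarith
    have := mul_nonneg hK₂0 hD0
    linarith

namespace FeedbackInput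

variable {Ω : Type*}

/-- All primitive times are nonnegative. -/
def IsNonneg (Q : FeedbackInput Ω) (ω : Ω) : Prop :=
  (∀ n, 0 ≤ Q.interarrival n ω) ∧ (∀ k i, 0 ≤ Q.service k i ω) ∧ 0 ≤ Q.first ω

/-- If the stage `j + 1` lasts about `Y`, and arrivals, services and returns are close to their
averages, then the state after `n` more stages is close to a multiple of `Y`. -/
lemma exists_state_error_bound {a b p : ℝ} (ha : 0 < a) (hb : 0 ≤ b) (hp : 0 ≤ p)
    (hr : p + 1 / a * b ≠ 1) (n : ℕ) :
    ∃ K ≥ 0, ∀ (Q : FeedbackInput Ω) (ω : Ω) (j : ℕ) (ε C Y : ℝ), Q.IsNonneg ω →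
      0 ≤ ε → ε ≤ 1 → ε ≤ a / 2 → 1 ≤ C → a ≤ C → 0 ≤ Y →
      (∀ m : ℕ, |∑ i ∈ Finset.range m, Q.interarrival i ω - m * a| ≤ ε * m + C) →
      (∀ l < n, ∀ m : ℕ, |∑ i ∈ Finset.range m, Q.service (j + 2 + l) i ω - m * b| ≤ ε * m + C) →
      (∀ l < n, ∀ m : ℕ, |(Q.numReturns (j + 2 + l) m ω : ℝ) - m * p| ≤ ε * m + C) →
      Q.T j ω ≤ C → (Q.X j ω : ℝ) ≤ C → |Q.stage (j + 1) (Q.X j ω) ω - Y| ≤ C →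
      |Q.T (j + 1 + n) ω - (1 + meanQueue (1 / a) b p n) * Y| ≤ K * (ε * Y + C) ∧
      |(Q.X (j + 1 + n) ω : ℝ) - 1 / a * (p + 1 / a * b) ^ n * Y| ≤ K * (ε * Y + C) := by
  induction n with
  | zero =>
    refine ⟨2 + (20 + 10 / a + a) / a, by positivity, ?_⟩
    intro Q ω j ε C Y hnn hε hε1 hεa hC1 hCa hY hA _ _ hT hX hU
    have hT0 := T_nonneg hnn.2.2 hnn.2.1 j
    have hT0' := T_nonneg hnn.2.2 hnn.2.1 (j + 1)
    have hN := abs_arrivals_sub_le ha hε hεa hCa hnn.1 hA hT0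
    have hN' := abs_arrivals_sub_le ha hε hεa hCa hnn.1 hA hT0'
    have hfin : ∀ s, {n : ℕ | 1 ≤ n ∧ ∑ j ∈ Finset.range n, Q.interarrival j ω ≤ s}.Finite := by
      refine finite_arrivals (half_pos ha) (z := C) fun m => ?_
      have h1 := (abs_le.1 (hA m)).1
      have h2 : ε * m ≤ a / 2 * m := by gcongr
      linarith
    have hle : Q.T j ω ≤ Q.T (j + 1) ω := by
      rw [T_succ]; linarith [stage_nonneg hnn.2.2 hnn.2.1 (j + 1) (Q.X j ω)]
    have hmono := arrivals_mono (hfin (Q.T (j + 1) ω)) hle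
    have hD : C ≤ ε * Y + C := by have := mul_nonneg hε hY; linarith
    set D := ε * Y + C with hDdef
    have hD0 : 0 ≤ D := by linarith
    have h2a : 0 ≤ 2 / a := by positivity
    have hT1 : |Q.T (j + 1) ω - Y| ≤ 2 * C := by
      have h1 : Q.T (j + 1) ω - Y = Q.T j ω + (Q.stage (j + 1) (Q.X j ω) ω - Y) := by
        rw [T_succ]; ring
      rw [h1]
      refine (abs_add_le _ _).trans ?_
      rw [abs_of_nonneg hT0]
      linarith
    have hεT : ε * Q.T (j + 1) ω ≤ 3 * D := by
      have h1 : Q.T (j + 1) ω ≤ Y + 2 * C := by have := (abs_le.1 hT1).2; linarith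
      calc ε * Q.T (j + 1) ω ≤ ε * (Y + 2 * C) := by gcongr
        _ = ε * Y + 2 * (ε * C) := by ring
        _ ≤ ε * Y + 2 * (1 * C) := by gcongr
        _ ≤ 3 * D := by linarith
    have hεT0 : ε * Q.T j ω ≤ D := by
      calc ε * Q.T j ω ≤ 1 * C := by gcongr
        _ ≤ D := by linarith
    have hB : (Q.numReturns (j + 1) (Q.X j ω) ω : ℝ) ≤ C :=
      le_trans (Nat.cast_le.2 (numReturns_le _ _ _)) hX
    have hB0 : (0 : ℝ) ≤ Q.numReturns (j + 1) (Q.X j ω) ω := Nat.cast_nonneg _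
    have hN0 : 0 ≤ a * (Q.arrivals (Q.T j ω) ω : ℝ) := by positivity
    have hX1 : |a * ((Q.X (j + 1) ω : ℝ) - 1 / a * Y)| ≤ (20 + 10 / a + a) * D := by
      have h1 : a * ((Q.X (j + 1) ω : ℝ) - 1 / a * Y) =
          (a * Q.arrivals (Q.T (j + 1) ω) ω - Q.T (j + 1) ω) + (Q.T (j + 1) ω - Y) -
          a * Q.arrivals (Q.T j ω) ω + a * Q.numReturns (j + 1) (Q.X j ω) ω := by
        rw [X_succ, Nat.cast_add, Nat.cast_sub hmono]
        field_simp; ring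
      rw [h1]
      have h3 := mul_le_mul_of_nonneg_left hεT h2a
      have h4 := mul_le_mul_of_nonneg_left hεT0 h2a
      have h5 := mul_le_mul_of_nonneg_left (hB.trans hD) ha.le
      have h6 := mul_nonneg ha.le hB0
      have h7 := mul_nonneg ha.le hD0
      have h8 : 10 / a * D = 2 / a * (3 * D) + 2 / a * D + 2 / a * D := by ring
      have h9 : 0 ≤ 2 / a * D := by positivity
      rw [abs_le] at hN hN' hT1 ⊢
      constructor <;> linarith
    have hq : 0 ≤ (20 + 10 / a + a) / a * D := by positivity
    simp only [meanQueue_zero, add_zero, one_mul, pow_zero, mul_one]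
    constructor
    · linarith
    · rw [abs_mul, abs_of_pos ha] at hX1
      have h1 : |(Q.X (j + 1) ω : ℝ) - 1 / a * Y| ≤ (20 + 10 / a + a) / a * D := by
        rw [show (20 + 10 / a + a) / a * D = (20 + 10 / a + a) * D / a by ring, le_div_iff₀ ha]
        linarith
      linarith
  | succ n ih =>
    obtain ⟨K, hK, hind⟩ := ih
    have hm := meanQueue_nonneg (by positivity : 0 ≤ 1 / a) hb hp hr n
    obtain ⟨K', hK', hstep⟩ := exists_stage_error_bound (cT := 1 + meanQueue (1 / a) b p n)
      (cX := 1 / a * (p + 1 / a * b) ^ n) ha hb hp (by linarith) (by positivity) hK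
    refine ⟨K', hK', ?_⟩
    intro Q ω j ε C Y hnn hε hε1 hεa hC1 hCa hY hA hS hR hT hX hU
    obtain ⟨h1, h2⟩ := hind Q ω j ε C Y hnn hε hε1 hεa hC1 hCa hY hA
      (fun l hl => hS l (by omega)) (fun l hl => hR l (by omega)) hT hX hU
    set i := j + 1 + n with hi
    have hfin : ∀ s, {n : ℕ | 1 ≤ n ∧ ∑ j ∈ Finset.range n, Q.interarrival j ω ≤ s}.Finite := by
      refine finite_arrivals (half_pos ha) (z := C) fun m => ?_
      have h1 := (abs_le.1 (hA m)).1
      have h2 : ε * m ≤ a / 2 * m := by gcongr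
      linarith
    have hle : Q.T i ω ≤ Q.T (i + 1) ω := by
      rw [T_succ]; linarith [stage_nonneg hnn.2.2 hnn.2.1 (i + 1) (Q.X i ω)]
    have hmono := arrivals_mono (hfin (Q.T (i + 1) ω)) hle
    have hstage := hS n n.lt_succ_self (Q.X i ω + 1)
    have hret := hR n n.lt_succ_self (Q.X i ω)
    rw [show j + 2 + n = i + 1 by omega] at hstage hret
    rw [← stage_of_ne_one (show i + 1 ≠ 1 by omega)] at hstage
    push_cast at hstage
    have h3 := hstep ε C Y (Q.T i ω) (Q.stage (i + 1) (Q.X i ω) ω) (Q.X i ω)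
      (Q.arrivals (Q.T i ω) ω) (Q.arrivals (Q.T (i + 1) ω) ω)
      (Q.numReturns (i + 1) (Q.X i ω) ω) hε hε1 hC1 hY h1 h2 hstage hret
      (abs_arrivals_sub_le ha hε hεa hCa hnn.1 hA (T_nonneg hnn.2.2 hnn.2.1 i))
      (abs_arrivals_sub_le ha hε hεa hCa hnn.1 hA (T_nonneg hnn.2.2 hnn.2.1 (i + 1)))
    rw [show j + 1 + (n + 1) = i + 1 by omega, T_succ, X_succ, Nat.cast_add, Nat.cast_sub hmono,
      meanQueue_succ hr, ← add_assoc, pow_succ']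
    refine ⟨h3.1, ?_⟩
    have h4 := h3.2
    rwa [show (p + 1 / a * b) * (1 / a * (p + 1 / a * b) ^ n) * Y =
      1 / a * ((p + 1 / a * b) * (p + 1 / a * b) ^ n) * Y by ring] at h4

end FeedbackInput

/-! ### Adding up nearly disjoint rare events. -/

section Disjointification

variable {Ω ι : Type*} [MeasurableSpace Ω] {P : Measure Ω} [IsProbabilityMeasure P]

/-- A lower bound for the probability of a union of events each of which contains the intersection of
a rare event with an event independent of it. -/
lemma sum_le_measureReal_biUnion [DecidableEq ι] (S : Finset ι) (B Γ : ι → Set Ω)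
    (hB : ∀ s ∈ S, MeasurableSet (B s)) (hΓ : ∀ s ∈ S, MeasurableSet (Γ s))
    (hind : ∀ s ∈ S, P.real (Γ s ∩ B s) = P.real (Γ s) * P.real (B s))
    (hpair : ∀ s ∈ S, ∀ s' ∈ S, s ≠ s' → P.real (B s ∩ B s') = P.real (B s) * P.real (B s')) :
    ∑ s ∈ S, (P.real (Γ s) - ∑ s' ∈ S, P.real (B s')) * P.real (B s) ≤
      P.real (⋃ s ∈ S, Γ s ∩ B s) := by
  -- Removing the other rare events makes the pieces disjoint; pairwise independence bounds the loss
  -- by `P (B s)` times the sum of all `P (B s')`.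
  set D : ι → Set Ω := fun s => (Γ s ∩ B s) \ ⋃ s' ∈ S.erase s, B s' with hD
  have hDm : ∀ s ∈ S, MeasurableSet (D s) := fun s hs => ((hΓ s hs).inter (hB s hs)).diff
    (Finset.measurableSet_biUnion _ fun s' hs' => hB s' (Finset.mem_of_mem_erase hs'))
  have hdisj : (S : Set ι).PairwiseDisjoint D := by
    intro s _ s' hs' hne
    refine Set.disjoint_left.2 fun ω h1 h2 => h1.2 ?_
    simp only [Set.mem_iUnion]
    exact ⟨s', Finset.mem_erase.2 ⟨hne.symm, hs'⟩, h2.1.2⟩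
  have hle : ∀ s ∈ S, (P.real (Γ s) - ∑ s' ∈ S, P.real (B s')) * P.real (B s) ≤ P.real (D s) := by
    intro s hs
    have hsub : Γ s ∩ B s ⊆ D s ∪ ⋃ s' ∈ S.erase s, (B s ∩ B s') := by
      intro ω hω
      by_cases h : ω ∈ ⋃ s' ∈ S.erase s, B s'
      · right
        simp only [Set.mem_iUnion] at h ⊢
        obtain ⟨s', h1, h2⟩ := h
        exact ⟨s', h1, hω.2, h2⟩
      · exact Or.inl ⟨hω, h⟩
    have h1 := (measureReal_mono hsub (measure_ne_top P _)).trans (measureReal_union_le _ _)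
    have h2 : P.real (⋃ s' ∈ S.erase s, (B s ∩ B s')) ≤
        (∑ s' ∈ S, P.real (B s')) * P.real (B s) := by
      refine (measureReal_biUnion_finset_le _ _).trans ?_
      rw [Finset.sum_mul]
      refine (Finset.sum_le_sum fun s' hs' => (hpair s hs s' (Finset.mem_of_mem_erase hs')
        (Finset.ne_of_mem_erase hs').symm).le.trans_eq (mul_comm _ _)).trans ?_
      exact Finset.sum_le_sum_of_subset_of_nonneg (Finset.erase_subset _ _)
        fun _ _ _ => mul_nonneg measureReal_nonneg measureReal_nonneg
    rw [hind s hs] at h1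
    rw [sub_mul]
    linarith
  calc _ ≤ ∑ s ∈ S, P.real (D s) := Finset.sum_le_sum hle
    _ = P.real (⋃ s ∈ S, D s) := (measureReal_biUnion_finset hdisj hDm).symm
    _ ≤ _ := measureReal_mono (Set.iUnion₂_mono fun s _ => Set.sdiff_subset) (measure_ne_top _ _)

end Disjointification

/-! ### Laws of large numbers with a random additive constant. -/

section LawOfLargeNumbers

variable {Ω : Type*} [MeasurableSpace Ω] {P : Measure Ω}

/-- The finitely many indices before the limit takes hold are absorbed by `C`, which makes the bound
valid for every `n`. -/
lemma eventually_abs_sub_le_of_tendsto {u : ℕ → ℝ} {μ ε : ℝ} (hu0 : u 0 = 0) (hε : 0 < ε)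
    (h : Tendsto (fun n : ℕ => u n / n) atTop (𝓝 μ)) :
    ∀ᶠ C : ℕ in atTop, ∀ n : ℕ, |u n - n * μ| ≤ ε * n + C := by
  obtain ⟨n₀, hn₀⟩ := Metric.tendsto_atTop.1 h ε hε
  filter_upwards [eventually_ge_atTop ⌈∑ i ∈ Finset.range n₀, |u i - i * μ|⌉₊] with C hC n
  have hC' : ∑ i ∈ Finset.range n₀, |u i - i * μ| ≤ C := Nat.ceil_le.1 hC
  rcases lt_or_ge n n₀ with hn | hn
  · have h1 := Finset.single_le_sum (f := fun i : ℕ => |u i - i * μ|)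
      (fun i _ => abs_nonneg _) (Finset.mem_range.2 hn)
    have h2 : 0 ≤ ε * n := by positivity
    linarith
  · rcases Nat.eq_zero_or_pos n with rfl | hn0
    · simp [hu0]
    · have hn0' : (0 : ℝ) < n := by exact_mod_cast hn0
      have h1 := hn₀ n hn
      rw [Real.dist_eq] at h1
      have h2 : u n - n * μ = n * (u n / n - μ) := by field_simp
      rw [h2, abs_mul, abs_of_pos hn0']
      have h3 : (n : ℝ) * |u n / n - μ| ≤ n * ε := by gcongr
      have h4 : (0 : ℝ) ≤ C := Nat.cast_nonneg _
      linarith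

lemma ae_eventually_abs_sum_sub_le {Y : ℕ → Ω → ℝ} (hm : ∀ i, Measurable (Y i))
    (hind : iIndepFun Y P) (hlaw : ∀ i, P.map (Y i) = P.map (Y 0)) (hY : Integrable (Y 0) P)
    {ε : ℝ} (hε : 0 < ε) :
    ∀ᵐ ω ∂P, ∀ᶠ C : ℕ in atTop, ∀ n : ℕ,
      |∑ i ∈ Finset.range n, Y i ω - n * ∫ ω, Y 0 ω ∂P| ≤ ε * n + C := by
  have h := strong_law_ae_real Y hY (fun i j hij => hind.indepFun hij)
    (fun i => ⟨(hm i).aemeasurable, (hm 0).aemeasurable, hlaw i⟩)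
  filter_upwards [h] with ω hω
  exact eventually_abs_sub_le_of_tendsto (u := fun n => ∑ i ∈ Finset.range n, Y i ω) (by simp) hε hω

end LawOfLargeNumbers

/-! ### The lower bound. -/

namespace FeedbackInput

variable {Ω : Type*} {Q : FeedbackInput Ω} [mΩ : MeasurableSpace Ω] {P : Measure Ω}
  [IsProbabilityMeasure P] {A G H : Measure ℝ} {p : ℝ}

omit [IsProbabilityMeasure P] in
lemma IsGIGI1.ae_interarrival_lln (hQ : Q.IsGIGI1 P A G H p) (hA : IsNonnegLawWithMean A)
    {ε : ℝ} (hε : 0 < ε) :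
    ∀ᵐ ω ∂P, ∀ᶠ C : ℕ in atTop, ∀ n : ℕ,
      |∑ i ∈ Finset.range n, Q.interarrival i ω - n * mean A| ≤ ε * n + C := by
  have hm : ∀ i, Measurable (Q.interarrival i) := fun i => hQ.measurable_var (.interarrival i)
  have h0 := hA.integrable
  rw [← hQ.law_interarrival 0] at h0
  have h := ae_eventually_abs_sum_sub_le hm hQ.indep_interarrival
    (fun i => (hQ.law_interarrival i).trans (hQ.law_interarrival 0).symm)
    ((integrable_map_measure measurable_id.aestronglyMeasurable (hm 0).aemeasurable).1 h0) hε
  have hmean : ∫ ω, Q.interarrival 0 ω ∂P = mean A := by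
    rw [mean, ← hQ.law_interarrival 0, integral_map (f := fun y : ℝ => y) (hm 0).aemeasurable
      measurable_id.aestronglyMeasurable]
  rwa [hmean] at h

omit [IsProbabilityMeasure P] in
lemma IsGIGI1.ae_service_lln (hQ : Q.IsGIGI1 P A G H p) (hG : IsNonnegLawWithMean G) (k : ℕ)
    {ε : ℝ} (hε : 0 < ε) :
    ∀ᵐ ω ∂P, ∀ᶠ C : ℕ in atTop, ∀ n : ℕ,
      |∑ i ∈ Finset.range n, Q.service k i ω - n * mean G| ≤ ε * n + C := by
  have hm : ∀ i, Measurable (Q.service k i) := fun i => hQ.measurable_var (.service k i)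
  have h0 := hG.integrable
  rw [← hQ.law_service k 0] at h0
  have h := ae_eventually_abs_sum_sub_le hm (hQ.indep_service k)
    (fun i => (hQ.law_service k i).trans (hQ.law_service k 0).symm)
    ((integrable_map_measure measurable_id.aestronglyMeasurable (hm 0).aemeasurable).1 h0) hε
  have hmean : ∫ ω, Q.service k 0 ω ∂P = mean G := by
    rw [mean, ← hQ.law_service k 0, integral_map (f := fun y : ℝ => y) (hm 0).aemeasurable
      measurable_id.aestronglyMeasurable]
  rwa [hmean] at h

lemma IsGIGI1.ae_returns_lln (hQ : Q.IsGIGI1 P A G H p) (k : ℕ) {ε : ℝ} (hε : 0 < ε) :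
    ∀ᵐ ω ∂P, ∀ᶠ C : ℕ in atTop, ∀ n : ℕ, |(Q.numReturns k n ω : ℝ) - n * p| ≤ ε * n + C := by
  have h := ae_eventually_abs_sum_sub_le (fun j => hQ.measurable_var (.returns k (j + 1)))
    (hQ.indep_returns k) (fun i => hQ.map_comp_returns (fun y => y) k (i + 1) k (0 + 1))
    (hQ.integral_returns k (0 + 1)).1 hε
  rw [(hQ.integral_returns k (0 + 1)).2] at h
  simpa only [numReturns_eq_sum_range] using h

/-- A large value of the variable with label `s`, which contributes to the stage `j + 1` on the event
`E`, makes the tagged customer finish late, up to an event that is independent of this variable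
and has small probability. -/
lemma IsGIGI1.exists_good_event (hQ : Q.IsGIGI1 P A G H p) (hA : IsNonnegLawWithMean A)
    (hA0 : 0 < mean A) (hG : IsNonnegLawWithMean G) (hp : 0 ≤ p)
    (hr : p + 1 / mean A * mean G ≠ 1) {s : Source} {j : ℕ} (n : ℕ) {rest : Ω → ℝ} {E : Set Ω}
    (hs1 : ∀ i, s ≠ .interarrival i)
    (hs2 : ∀ l i, j + 1 < l → s ≠ .service l i ∧ s ≠ .returns l i)
    (hX : Measurable[Q.varSigma {s}ᶜ] (Q.X j)) (hT : Measurable[Q.varSigma {s}ᶜ] (Q.T j))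
    (hrest : Measurable[Q.varSigma {s}ᶜ] rest) (hE : MeasurableSet[Q.varSigma {s}ᶜ] E)
    (hstage : ∀ ω ∈ E, Q.stage (j + 1) (Q.X j ω) ω = Q.var s ω + rest ω)
    (hrest0 : ∀ ω, Q.IsNonneg ω → 0 ≤ rest ω) {ρ η : ℝ} (hρ : 1 < ρ) (hη : 0 < η) :
    ∃ Γ, MeasurableSet[Q.varSigma {s}ᶜ] Γ ∧ P.real E - η ≤ P.real Γ ∧
      ∀ᶠ x in atTop, ∀ ω ∈ Γ, Q.IsNonneg ω →
        ρ * x / (1 + meanQueue (1 / mean A) (mean G) p n) < Q.var s ω → x < Q.T (j + 1 + n) ω := by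
  obtain ⟨K, hK, hbound⟩ := exists_state_error_bound (Ω := Ω) hA0 hG.mean_nonneg hp hr n
  set μ := 1 + meanQueue (1 / mean A) (mean G) p n with hμ
  have hμ1 : 1 ≤ μ := by
    have := meanQueue_nonneg (by positivity : 0 ≤ 1 / mean A) hG.mean_nonneg hp hr n
    linarith
  have hρ0 : 0 < ρ := by linarith
  -- The relative error may use half of the gap between `ρ * x` and `x`; the other half covers the
  -- constant `K * C` for large `x`.
  obtain ⟨ε, hε0, hε1, hεa, hεK⟩ : ∃ ε > 0, ε ≤ 1 ∧ ε ≤ mean A / 2 ∧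
      K * ε ≤ μ * ((ρ - 1) / (2 * ρ)) := by
    have hq : 0 < μ * ((ρ - 1) / (2 * ρ)) :=
      mul_pos (by linarith) (div_pos (by linarith) (by linarith))
    refine ⟨min (min 1 (mean A / 2)) (μ * ((ρ - 1) / (2 * ρ)) / (K + 1)), ?_, ?_, ?_, ?_⟩
    · have : 0 < mean A / 2 := by positivity
      positivity
    · exact (min_le_left _ _).trans (min_le_left _ _)
    · exact (min_le_left _ _).trans (min_le_right _ _)
    · calc K * _ ≤ K * (μ * ((ρ - 1) / (2 * ρ)) / (K + 1)) := by gcongr; exact min_le_right _ _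
        _ = μ * ((ρ - 1) / (2 * ρ)) * (K / (K + 1)) := by ring
        _ ≤ μ * ((ρ - 1) / (2 * ρ)) * 1 := by
          gcongr; rw [div_le_one (by linarith)]; linarith
        _ = _ := mul_one _
  set Γ : ℕ → Set Ω := fun C => {ω | ω ∈ E ∧ (Q.X j ω : ℝ) ≤ C ∧ Q.T j ω ≤ C ∧ rest ω ≤ C ∧
    (∀ m : ℕ, |∑ i ∈ Finset.range m, Q.interarrival i ω - m * mean A| ≤ ε * m + C) ∧
    (∀ l ∈ Finset.range n, ∀ m : ℕ,
      |∑ i ∈ Finset.range m, Q.service (j + 2 + l) i ω - m * mean G| ≤ ε * m + C) ∧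
    (∀ l ∈ Finset.range n, ∀ m : ℕ,
      |(Q.numReturns (j + 2 + l) m ω : ℝ) - m * p| ≤ ε * m + C)} with hΓ
  have hvm : ∀ {s'}, s' ≠ s → Measurable[Q.varSigma {s}ᶜ] (Q.var s') := fun h =>
    measurable_var_varSigma h
  have hΓm : ∀ C, MeasurableSet[Q.varSigma {s}ᶜ] (Γ C) := by
    intro C
    -- Measurability with respect to the variables other than `s` is what makes the event
    -- independent of the jump.
    let _ : MeasurableSpace Ω := Q.varSigma {s}ᶜ
    have h1 : MeasurableSet {ω | ∀ m : ℕ,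
        |∑ i ∈ Finset.range m, Q.interarrival i ω - m * mean A| ≤ ε * m + C} := by
      rw [Set.ofPred_forall]
      refine MeasurableSet.iInter fun m => measurableSet_le ?_ measurable_const
      have h : Measurable fun ω => ∑ i ∈ Finset.range m, Q.interarrival i ω :=
        Finset.measurable_fun_sum _ fun i _ => hvm (s' := .interarrival i) (hs1 i).symm
      exact (h.sub measurable_const).abs
    have h2 : MeasurableSet {ω | ∀ l ∈ Finset.range n, ∀ m : ℕ,
        |∑ i ∈ Finset.range m, Q.service (j + 2 + l) i ω - m * mean G| ≤ ε * m + C} := by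
      simp only [Set.ofPred_forall]
      refine MeasurableSet.iInter fun l => MeasurableSet.iInter fun _ => MeasurableSet.iInter
        fun m => measurableSet_le ?_ measurable_const
      have h : Measurable fun ω => ∑ i ∈ Finset.range m, Q.service (j + 2 + l) i ω :=
        Finset.measurable_fun_sum _ fun i _ => hvm (s' := .service (j + 2 + l) i)
          (hs2 _ i (by omega)).1.symm
      exact (h.sub measurable_const).abs
    have h3 : MeasurableSet {ω | ∀ l ∈ Finset.range n, ∀ m : ℕ,
        |(Q.numReturns (j + 2 + l) m ω : ℝ) - m * p| ≤ ε * m + C} := by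
      simp only [Set.ofPred_forall]
      refine MeasurableSet.iInter fun l => MeasurableSet.iInter fun _ => MeasurableSet.iInter
        fun m => measurableSet_le ?_ measurable_const
      have h : Measurable fun ω => Q.numReturns (j + 2 + l) m ω :=
        measurable_numReturns (fun i => hvm (hs2 _ i (by omega)).2.symm) measurable_const
      exact ((measurable_from_nat.comp h).sub measurable_const).abs
    have h4 : MeasurableSet {ω | (Q.X j ω : ℝ) ≤ C} :=
      measurableSet_le (measurable_from_nat.comp hX) measurable_const
    have h5 : MeasurableSet {ω | Q.T j ω ≤ C} := measurableSet_le hT measurable_const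
    have h6 : MeasurableSet {ω | rest ω ≤ C} := measurableSet_le hrest measurable_const
    exact hE.inter (h4.inter (h5.inter (h6.inter (h1.inter (h2.inter h3)))))
  have hle := hQ.varSigma_le {s}ᶜ
  -- Almost every outcome in `E` satisfies all the bounds once `C` is large, so a fixed `C` loses at
  -- most `η`.
  have hlim : Tendsto (fun C => P (Γ C)) atTop (𝓝 (P E)) := by
    refine tendsto_measure_of_ae_tendsto_indicator_of_isFiniteMeasure atTop (hle _ hE)
      (fun C => hle _ (hΓm C)) ?_
    have hS : ∀ᵐ ω ∂P, ∀ l : ℕ, ∀ᶠ C : ℕ in atTop, ∀ m : ℕ,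
        |∑ i ∈ Finset.range m, Q.service (j + 2 + l) i ω - m * mean G| ≤ ε * m + C :=
      ae_all_iff.2 fun l => hQ.ae_service_lln hG _ hε0
    have hR : ∀ᵐ ω ∂P, ∀ l : ℕ, ∀ᶠ C : ℕ in atTop, ∀ m : ℕ,
        |(Q.numReturns (j + 2 + l) m ω : ℝ) - m * p| ≤ ε * m + C :=
      ae_all_iff.2 fun l => hQ.ae_returns_lln _ hε0
    filter_upwards [hQ.ae_interarrival_lln hA hε0, hS, hR] with ω h1 h2 h3
    have hbd : ∀ y : ℝ, ∀ᶠ C : ℕ in atTop, y ≤ C := fun y =>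
      tendsto_natCast_atTop_atTop.eventually (eventually_ge_atTop y)
    filter_upwards [h1, (Finset.eventually_all (Finset.range n)).2 fun l _ => h2 l,
      (Finset.eventually_all (Finset.range n)).2 fun l _ => h3 l, hbd (Q.X j ω), hbd (Q.T j ω),
      hbd (rest ω)] with C c1 c2 c3 c4 c5 c6
    exact ⟨fun h => h.1, fun h => ⟨h, c4, c5, c6, c1, c2, c3⟩⟩
  have hlim' : Tendsto (fun C => P.real (Γ C)) atTop (𝓝 (P.real E)) :=
    (ENNReal.tendsto_toReal (measure_ne_top P E)).comp hlim
  obtain ⟨C, hC1, hC2, hC3⟩ := ((hlim'.eventually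
    (lt_mem_nhds (show P.real E - η < P.real E by linarith))).and
    ((tendsto_natCast_atTop_atTop.eventually (eventually_ge_atTop (1 : ℝ))).and
    (tendsto_natCast_atTop_atTop.eventually (eventually_ge_atTop (mean A))))).exists
  refine ⟨Γ C, hΓm C, hC1.le, ?_⟩
  filter_upwards [eventually_gt_atTop (2 * (K * C) / (ρ - 1)), eventually_ge_atTop 0]
    with x hx hx0 ω ⟨g1, g2, g3, g4, g5, g6, g7⟩ hnn hY
  rw [div_lt_iff₀ (by linarith)] at hx
  have hY0 : 0 ≤ Q.var s ω := le_trans (by positivity) hY.le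
  have h1 := (hbound Q ω j ε C (Q.var s ω) hnn hε0.le hε1 hεa hC2 hC3 hY0 g5
    (fun l hl => g6 l (Finset.mem_range.2 hl)) (fun l hl => g7 l (Finset.mem_range.2 hl)) g3 g2
    (by rw [hstage ω g1, add_sub_cancel_left, abs_of_nonneg (hrest0 ω hnn)]; exact g4)).1
  have h2 := (abs_le.1 h1).1
  have h3 : K * ε * Q.var s ω ≤ μ * ((ρ - 1) / (2 * ρ)) * Q.var s ω := by gcongr
  have h4 : ρ * x < μ * Q.var s ω := by rwa [div_lt_iff₀' (by linarith)] at hY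
  have h5 : μ * Q.var s ω - μ * ((ρ - 1) / (2 * ρ)) * Q.var s ω =
      (ρ + 1) / (2 * ρ) * (μ * Q.var s ω) := by field_simp; ring
  have h6 : (ρ + 1) / (2 * ρ) * (ρ * x) ≤ (ρ + 1) / (2 * ρ) * (μ * Q.var s ω) := by gcongr
  have h7 : (ρ + 1) / (2 * ρ) * (ρ * x) = x + (ρ - 1) * x / 2 := by field_simp; ring
  have h8 : K * (ε * Q.var s ω + C) = K * ε * Q.var s ω + K * C := by ring
  linarith

end FeedbackInput

/-- The labels of the variables that can be the big jump: the first service of the tagged customer, or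
the `i`-th service in the stage `j + 2`. -/
def jumpSource : Option (ℕ × ℕ) → Source
  | none => .first
  | some q => .service (q.1 + 2) q.2

lemma jumpSource_injective : Function.Injective jumpSource := by
  rintro (_ | ⟨j, i⟩) (_ | ⟨j', i'⟩) h
  · rfl
  · exact absurd h (by simp [jumpSource])
  · exact absurd h (by simp [jumpSource])
  · simp only [jumpSource, Source.service.injEq, Nat.add_right_cancel_iff] at h
    rw [h.1, h.2]

/-- The tail-sum formula for `E(1 + N)`: services are numbered from `0`, and the truncated count is
`min I (N + 1)`. Truncation keeps the set of possible jumps finite. -/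
lemma tendsto_sum_measureReal_le {Ω : Type*} [MeasurableSpace Ω] {P : Measure Ω}
    [IsProbabilityMeasure P] {N : Ω → ℕ} (hN : Measurable N)
    (hNi : Integrable (fun ω => (N ω : ℝ)) P) :
    Tendsto (fun I : ℕ => ∑ i ∈ Finset.range I, P.real {ω | i ≤ N ω}) atTop
      (𝓝 (∫ ω, (1 + (N ω : ℝ)) ∂P)) := by
  have hset : ∀ i, MeasurableSet {ω | i ≤ N ω} := fun i => measurableSet_le measurable_const hN
  have h1 : ∀ I : ℕ, ∑ i ∈ Finset.range I, P.real {ω | i ≤ N ω} =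
      ∫ ω, ∑ i ∈ Finset.range I, {ω | i ≤ N ω}.indicator (1 : Ω → ℝ) ω ∂P := by
    intro I
    have hi : ∀ i, Integrable ({ω | i ≤ N ω}.indicator (1 : Ω → ℝ)) P := fun i =>
      (integrable_const (1 : ℝ)).indicator (hset i)
    rw [integral_finsetSum _ fun i _ => hi i]
    exact Finset.sum_congr rfl fun i _ => (integral_indicator_one (hset i)).symm
  have h2 : ∀ (I : ℕ) (ω : Ω), ∑ i ∈ Finset.range I, {ω | i ≤ N ω}.indicator (1 : Ω → ℝ) ω =
      (min I (N ω + 1) : ℕ) := by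
    intro I ω
    simp only [Set.indicator_apply, Set.mem_ofPred_eq, Pi.one_apply]
    rw [Finset.sum_boole]
    congr 1
    have : Finset.filter (fun i => i ≤ N ω) (Finset.range I) = Finset.range (min I (N ω + 1)) := by
      ext i; simp
    rw [this, Finset.card_range]
  simp_rw [h1, h2]
  refine tendsto_integral_of_dominated_convergence (fun ω => 1 + (N ω : ℝ)) (fun I => ?_)
    ((integrable_const _).add hNi) (fun I => Eventually.of_forall fun ω => ?_)
    (Eventually.of_forall fun ω => ?_)
  · exact (measurable_from_nat (f := fun m => ((min I (m + 1) : ℕ) : ℝ))|>.comp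
      hN).aestronglyMeasurable
  · rw [Real.norm_of_nonneg (Nat.cast_nonneg _)]
    have : ((min I (N ω + 1) : ℕ) : ℝ) ≤ ((N ω + 1 : ℕ) : ℝ) := Nat.cast_le.2 (min_le_right _ _)
    push_cast at this ⊢
    linarith
  · refine tendsto_const_nhds.congr' ?_
    filter_upwards [eventually_ge_atTop (N ω + 1)] with I hI
    rw [min_eq_right hI]
    push_cast
    ring

namespace FeedbackInput

variable {Ω : Type*} {Q : FeedbackInput Ω} [mΩ : MeasurableSpace Ω] {P : Measure Ω}
  [IsProbabilityMeasure P] {A G H : Measure ℝ} {p : ℝ}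

/-- The instance of `IsGIGI1.exists_good_event` for a large first service. -/
lemma IsGIGI1.exists_good_event_first (hQ : Q.IsGIGI1 P A G H p) (hA : IsNonnegLawWithMean A)
    (hA0 : 0 < mean A) (hG : IsNonnegLawWithMean G) (hp : 0 ≤ p)
    (hr : p + 1 / mean A * mean G ≠ 1) (k : ℕ) {ρ η : ℝ} (hρ : 1 < ρ) (hη : 0 < η) :
    ∃ Γ, MeasurableSet[Q.varSigma {.first}ᶜ] Γ ∧ 1 - η ≤ P.real Γ ∧
      ∀ᶠ x in atTop, ∀ ω ∈ Γ, Q.IsNonneg ω →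
        ρ * x / (1 + meanQueue (1 / mean A) (mean G) p k) < Q.first ω → x < Q.T (k + 1) ω := by
  obtain ⟨Γ, h1, h2, h3⟩ := hQ.exists_good_event hA hA0 hG hp hr (s := .first) (j := 0) k
    (rest := fun _ => 0) (E := Set.univ) (fun i => by simp) (fun l i _ => by simp)
    measurable_const measurable_const measurable_const MeasurableSet.univ
    (fun ω _ => by simp [stage, var]) (fun ω _ => le_rfl) hρ hη
  rw [probReal_univ] at h2
  refine ⟨Γ, h1, h2, ?_⟩
  rwa [show 0 + 1 + k = k + 1 by omega] at h3

omit mΩ in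
lemma measurable_sum_range_erase {m : MeasurableSpace Ω} {Y : ℕ → Ω → ℝ} {i : ℕ}
    (hY : ∀ i', i' ≠ i → Measurable (Y i')) {N : Ω → ℕ} (hN : Measurable N) :
    Measurable fun ω => ∑ i' ∈ (Finset.range (N ω + 1)).erase i, Y i' ω := by
  have h1 : Measurable fun q : ℕ × Ω => ∑ i' ∈ (Finset.range (q.1 + 1)).erase i, Y i' q.2 :=
    measurable_from_prod_countable_right fun n =>
      Finset.measurable_fun_sum ((Finset.range (n + 1)).erase i) fun i' hi' =>
        hY i' (Finset.ne_of_mem_erase hi')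
  exact h1.comp (hN.prodMk measurable_id)

/-- The instance of `IsGIGI1.exists_good_event` for a large service in a later stage. -/
lemma IsGIGI1.exists_good_event_service (hQ : Q.IsGIGI1 P A G H p) (hA : IsNonnegLawWithMean A)
    (hA0 : 0 < mean A) (hG : IsNonnegLawWithMean G) (hp : 0 ≤ p)
    (hr : p + 1 / mean A * mean G ≠ 1) {k j : ℕ} (hj : j < k) (i : ℕ) {ρ η : ℝ} (hρ : 1 < ρ)
    (hη : 0 < η) :
    ∃ Γ, MeasurableSet[Q.varSigma {.service (j + 2) i}ᶜ] Γ ∧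
      P.real {ω | i ≤ Q.X (j + 1) ω} - η ≤ P.real Γ ∧
      ∀ᶠ x in atTop, ∀ ω ∈ Γ, Q.IsNonneg ω →
        ρ * x / (1 + meanQueue (1 / mean A) (mean G) p (k - 1 - j)) < Q.service (j + 2) i ω →
          x < Q.T (k + 1) ω := by
  obtain ⟨hX, hT⟩ := measurable_X_T (m := Q.varSigma {.service (j + 2) i}ᶜ) (Q := Q) (k := j + 1)
    (fun s hs => measurable_var_varSigma (by
      rintro rfl
      exact absurd (show j + 2 ≤ j + 1 from hs) (by omega)))
  have hrest : Measurable[Q.varSigma {.service (j + 2) i}ᶜ] fun ω =>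
      ∑ i' ∈ (Finset.range (Q.X (j + 1) ω + 1)).erase i, Q.service (j + 2) i' ω := by
    refine measurable_sum_range_erase (fun i' hi' => ?_) hX
    exact measurable_var_varSigma (Q := Q) (s := .service (j + 2) i') (by simpa using hi')
  have hE : MeasurableSet[Q.varSigma {.service (j + 2) i}ᶜ] {ω | i ≤ Q.X (j + 1) ω} :=
    measurableSet_le measurable_const hX
  have hstage : ∀ ω ∈ {ω | i ≤ Q.X (j + 1) ω}, Q.stage (j + 1 + 1) (Q.X (j + 1) ω) ω =
      Q.var (.service (j + 2) i) ω +
        ∑ i' ∈ (Finset.range (Q.X (j + 1) ω + 1)).erase i, Q.service (j + 2) i' ω := by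
    intro ω hω
    have hi : i ∈ Finset.range (Q.X (j + 1) ω + 1) := Finset.mem_range.2 (Nat.lt_succ_of_le hω)
    rw [stage_of_ne_one (by omega)]
    exact (Finset.add_sum_erase _ (fun i' => Q.service (j + 2) i' ω) hi).symm
  have hlevel : ∀ l i', j + 1 + 1 < l →
      Source.service (j + 2) i ≠ .service l i' ∧ Source.service (j + 2) i ≠ .returns l i' := by
    intro l i' hl
    refine ⟨fun h => ?_, fun h => by injection h⟩
    injection h with h
    omega
  obtain ⟨Γ, h1, h2, h3⟩ := hQ.exists_good_event hA hA0 hG hp hr (k - 1 - j)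
    (fun i' h => by injection h) hlevel hX hT hrest hE hstage
    (fun ω hω => Finset.sum_nonneg fun i _ => hω.2.1 _ _) hρ hη
  refine ⟨Γ, h1, h2, ?_⟩
  rwa [show j + 1 + 1 + (k - 1 - j) = k + 1 by omega] at h3

/-- The lower half of the tail asymptotics. -/
lemma IsGIGI1.eventually_le_tail (hQ : Q.IsGIGI1 P A G H p) (hA : IsNonnegLawWithMean A)
    (hA0 : 0 < mean A) (hG : IsNonnegLawWithMean G) (hH : IsNonnegLawWithMean H) (hp : 0 ≤ p)
    (hr : p + 1 / mean A * mean G ≠ 1) (k I : ℕ) {ρ δ : ℝ} (hρ : 1 < ρ) (hδ : 0 < δ) :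
    ∀ᶠ x in atTop,
      ∑ j ∈ Finset.range k, ∑ i ∈ Finset.range I, (P.real {ω | i ≤ Q.X (j + 1) ω} - δ) *
          tail G (ρ * x / (1 + meanQueue (1 / mean A) (mean G) p (k - 1 - j))) +
        (1 - δ) * tail H (ρ * x / (1 + meanQueue (1 / mean A) (mean G) p k)) ≤
      P.real {ω | x < Q.T (k + 1) ω} := by
  have := hG.isProb
  have := hH.isProb
  -- `none` is the jump of `η`; `(j, i)` is the service `i` of the stage `j + 2`, after which `k - 1
  -- - j` stages remain up to the stage `k + 1`.
  set S := Finset.insertNone (Finset.range k ×ˢ Finset.range I) with hS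
  set lag : Option (ℕ × ℕ) → ℕ := fun o => o.elim k fun q => k - 1 - q.1 with hlag
  set w : Option (ℕ × ℕ) → ℝ := fun o => o.elim 1 fun q => P.real {ω | q.2 ≤ Q.X (q.1 + 1) ω}
    with hw
  set F : Option (ℕ × ℕ) → Measure ℝ := fun o => o.elim H fun _ => G with hF
  set c : Option (ℕ × ℕ) → ℝ := fun o => 1 + meanQueue (1 / mean A) (mean G) p (lag o) with hc
  have hc0 : ∀ o, 0 < c o := fun o => by
    have := meanQueue_nonneg (by positivity : 0 ≤ 1 / mean A) hG.mean_nonneg hp hr (lag o)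
    simp only [hc]
    linarith
  have hgood : ∀ o ∈ S, ∃ Γ, MeasurableSet[Q.varSigma {jumpSource o}ᶜ] Γ ∧
      w o - δ / 2 ≤ P.real Γ ∧ ∀ᶠ x in atTop, ∀ ω ∈ Γ, Q.IsNonneg ω →
        ρ * x / c o < Q.var (jumpSource o) ω → x < Q.T (k + 1) ω := by
    rintro (_ | ⟨j, i⟩) ho
    · exact hQ.exists_good_event_first hA hA0 hG hp hr k hρ (half_pos hδ)
    · have hj : j < k := by
        have := Finset.mem_insertNone.1 ho (j, i) rfl
        exact Finset.mem_range.1 (Finset.mem_product.1 this).1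
      exact hQ.exists_good_event_service hA hA0 hG hp hr hj i hρ (half_pos hδ)
  choose! Γ hΓm hΓP hΓx using hgood
  have hB : ∀ o x, P.real {ω | ρ * x / c o < Q.var (jumpSource o) ω} = tail (F o) (ρ * x / c o) := by
    rintro (_ | ⟨j, i⟩) x
    · exact real_lt_eq_tail (hQ.measurable_var .first) hQ.law_first _
    · exact real_lt_eq_tail (hQ.measurable_var (.service (j + 2) i)) (hQ.law_service _ _) _
  -- Bounds the loss from simultaneous jumps; it takes `δ / 2`, the good events the other half.
  have hsmall : Tendsto (fun x => ∑ o ∈ S, tail (F o) (ρ * x / c o)) atTop (𝓝 0) := by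
    rw [← Finset.sum_const_zero (s := S)]
    refine tendsto_finsetSum _ fun o _ => ?_
    have hp : IsProbabilityMeasure (F o) := by cases o <;> assumption
    refine tail_tendsto_zero.comp (Tendsto.atTop_div_const (hc0 o) ?_)
    exact tendsto_id.const_mul_atTop (by linarith)
  filter_upwards [hsmall.eventually (gt_mem_nhds (half_pos hδ)),
    (Finset.eventually_all S).2 hΓx] with x hx1 hx2
  classical
  set B : Option (ℕ × ℕ) → Set Ω := fun o => {ω | ρ * x / c o < Q.var (jumpSource o) ω} with hBdef
  have hBm : ∀ o, MeasurableSet (B o) := fun o =>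
    measurableSet_lt measurable_const (hQ.measurable_var _)
  have hmain := sum_le_measureReal_biUnion (P := P) S B Γ (fun o _ => hBm o)
    (fun o ho => hQ.varSigma_le _ _ (hΓm o ho))
    (fun o ho => Indep.measureReal_inter (hQ.indep_varSigma (S := {jumpSource o}ᶜ)
      (S' := {jumpSource o}) disjoint_compl_left) (hΓm o ho)
      (measurableSet_lt measurable_const (measurable_var_varSigma (Set.mem_singleton _))))
    (fun o _ o' _ hne => Indep.measureReal_inter
      (hQ.indep_varSigma (S := {jumpSource o}) (S' := {jumpSource o'})
        (Set.disjoint_singleton.2 (jumpSource_injective.ne hne)))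
      (measurableSet_lt measurable_const (measurable_var_varSigma (Set.mem_singleton _)))
      (measurableSet_lt measurable_const (measurable_var_varSigma (Set.mem_singleton _))))
  have hZ0 : P.real {ω | ¬ Q.IsNonneg ω} = 0 := by
    have h : P {ω | ¬ Q.IsNonneg ω} = 0 := ae_iff.1 (hQ.ae_nonneg hA hG hH)
    rw [Measure.real, h, ENNReal.toReal_zero]
  have hsub : ⋃ o ∈ S, Γ o ∩ B o ⊆ {ω | x < Q.T (k + 1) ω} ∪ {ω | ¬ Q.IsNonneg ω} := by
    intro ω hω
    simp only [Set.mem_iUnion] at hω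
    obtain ⟨o, ho, hΓo, hBo⟩ := hω
    by_cases hn : Q.IsNonneg ω
    · exact Or.inl (hx2 o ho ω hΓo hn hBo)
    · exact Or.inr hn
  have hupper := (measureReal_mono hsub (measure_ne_top P _)).trans (measureReal_union_le _ _)
  rw [hZ0, add_zero] at hupper
  refine le_trans ?_ (hmain.trans hupper)
  have hfin : ∑ o ∈ S, (w o - δ) * tail (F o) (ρ * x / c o) ≤
      ∑ o ∈ S, (P.real (Γ o) - ∑ o' ∈ S, P.real (B o')) * P.real (B o) := by
    refine Finset.sum_le_sum fun o ho => ?_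
    simp only [hBdef, hB]
    refine mul_le_mul_of_nonneg_right ?_ (tail_nonneg _ _)
    have := hΓP o ho
    linarith
  refine le_of_eq_of_le ?_ hfin
  rw [hS, Finset.sum_insertNone, Finset.sum_product, add_comm]
  rfl

end FeedbackInput

/-! ### Combining the two bounds. -/

lemma exists_dilation_sum_le {G H : Measure ℝ} (hG : IsIRV G)
    (hH : IsIRV H) [IsProbabilityMeasure G] [IsProbabilityMeasure H] (k : ℕ) {w c : ℕ → ℝ}
    (hw : ∀ l, 0 ≤ w l) (hc : ∀ l, 0 < c l) {ε : ℝ} (hε : 0 < ε) :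
    ∃ ρ, 0 < ρ ∧ ρ < 1 ∧ ∀ᶠ x in atTop,
      ∑ l ∈ Finset.range k, w l * tail G (ρ * x / c l) + tail H (ρ * x / c k) ≤
      (1 + ε) * (∑ l ∈ Finset.range k, w l * tail G (x / c l) + tail H (x / c k)) := by
  obtain ⟨ρ₁, h10, h11, h1⟩ := hG.eventually_tail_mul_le hε
  obtain ⟨ρ₂, h20, h21, h2⟩ := hH.eventually_tail_mul_le hε
  refine ⟨max ρ₁ ρ₂, lt_max_of_lt_left h10, max_lt h11 h21, ?_⟩
  have h3 : ∀ l, ∀ᶠ x in atTop, tail G (ρ₁ * (x / c l)) ≤ (1 + ε) * tail G (x / c l) := fun l =>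
    (tendsto_id.atTop_div_const (hc l)).eventually h1
  have h4 : ∀ᶠ x in atTop, tail H (ρ₂ * (x / c k)) ≤ (1 + ε) * tail H (x / c k) :=
    (tendsto_id.atTop_div_const (hc k)).eventually h2
  filter_upwards [(Finset.eventually_all (Finset.range k)).2 fun l _ => h3 l, h4,
    eventually_ge_atTop 0] with x h5 h6 hx
  rw [mul_add, Finset.mul_sum]
  refine add_le_add (Finset.sum_le_sum fun l hl => ?_) ?_
  · rw [mul_left_comm]
    refine mul_le_mul_of_nonneg_left (le_trans (tail_antitone ?_) (h5 l hl)) (hw l)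
    rw [mul_div_assoc]
    have := (hc l).le
    gcongr
    exact le_max_left _ _
  · refine le_trans (tail_antitone ?_) h6
    rw [mul_div_assoc]
    have := (hc k).le
    gcongr
    exact le_max_right _ _

namespace FeedbackInput

variable {Ω : Type*} {Q : FeedbackInput Ω} [mΩ : MeasurableSpace Ω] {P : Measure Ω}
  [IsProbabilityMeasure P] {A G H : Measure ℝ} {p : ℝ}

/-- Tail asymptotics for the completion time of the service `k + 1`, in terms of tail functions. -/
theorem IsGIGI1.isEquivalent_tail (hQ : Q.IsGIGI1 P A G H p) (hp0 : 0 < p)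
    (hA : IsNonnegLawWithMean A) (hA0 : 0 < mean A) (hG : IsNonnegLawWithMean G)
    (hr : p + 1 / mean A * mean G ≠ 1) (hGirv : IsIRV G) (hH : IsNonnegLawWithMean H)
    (hHirv : IsIRV H) (hX : ∀ k, Integrable (fun ω => (Q.X k ω : ℝ)) P) (k : ℕ) :
    (fun x : ℝ => P.real {ω | x < Q.T (k + 1) ω}) ~[atTop] fun x : ℝ =>
      ∑ l ∈ Finset.range k, (∫ ω, (1 + (Q.X (k - l) ω : ℝ)) ∂P) *
          tail G (x / (1 + meanQueue (1 / mean A) (mean G) p l)) +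
        tail H (x / (1 + meanQueue (1 / mean A) (mean G) p k)) := by
  have := hG.isProb
  have := hH.isProb
  -- For `k = 0` no `tail G` term is available to absorb the errors, but there `T_1` is exactly `η`.
  rcases Nat.eq_zero_or_pos k with rfl | hk
  · refine EventuallyEq.isEquivalent (Eventually.of_forall fun x => ?_)
    simp only [zero_add, T_one, Finset.range_zero, Finset.sum_empty, meanQueue_zero, add_zero,
      div_one]
    exact real_lt_eq_tail (hQ.measurable_var .first) hQ.law_first x
  have hXm : ∀ k, Measurable (Q.X k) := fun k =>
    (measurable_X_T (Q := Q) (k := k) fun s _ => hQ.measurable_var s).1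
  set v : ℕ → ℝ := fun j => ∫ ω, (1 + (Q.X j ω : ℝ)) ∂P with hv
  have hv1 : ∀ j, 1 ≤ v j := fun j => by
    have h0 : 0 ≤ ∫ ω, (Q.X j ω : ℝ) ∂P := integral_nonneg fun ω => Nat.cast_nonneg _
    have h1 : v j = 1 + ∫ ω, (Q.X j ω : ℝ) ∂P := by
      simp only [hv]
      rw [integral_add (integrable_const _) (hX j)]
      simp
    linarith
  set m : ℕ → ℝ := fun l => 1 + meanQueue (1 / mean A) (mean G) p l with hm
  have hm0 : ∀ l, 0 < m l := fun l => by
    have := meanQueue_nonneg (by positivity : 0 ≤ 1 / mean A) hG.mean_nonneg hp0.le hr l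
    simp only [hm]
    linarith
  set R : ℝ → ℝ := fun x => ∑ l ∈ Finset.range k, v (k - l) * tail G (x / m l) +
    tail H (x / m k) with hR
  have hterm : ∀ l x, 0 ≤ v (k - l) * tail G (x / m l) := fun l x =>
    mul_nonneg (by linarith [hv1 (k - l)]) (tail_nonneg _ _)
  have hR0 : ∀ x, 0 ≤ R x := fun x =>
    add_nonneg (Finset.sum_nonneg fun l _ => hterm l x) (tail_nonneg _ _)
  -- The term `l = 0` has `m_0 = 0` and weight at least `1`, so errors `ε * tail G x` are small
  -- relative to `R x`.
  have hGR : ∀ x, tail G x ≤ R x := fun x => by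
    have h1 := Finset.single_le_sum (f := fun l => v (k - l) * tail G (x / m l))
      (fun l _ => hterm l x) (Finset.mem_range.2 hk)
    have h2 : m 0 = 1 := by simp [hm, meanQueue_zero]
    simp only [h2, div_one, Nat.sub_zero] at h1
    have h3 : tail G x ≤ v k * tail G x := le_mul_of_one_le_left (tail_nonneg _ _) (hv1 k)
    have h4 := tail_nonneg H (x / m k)
    simp only [hR]
    linarith
  refine isLittleO_iff.2 fun c hc => ?_
  set ε := min (c / 2) (1 / 2) with hε
  have hε0 : 0 < ε := lt_min (by linarith) (by norm_num)
  have hεc : ε ≤ c / 2 := min_le_left _ _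
  obtain ⟨ρ, hρ0, hρ1, hreg⟩ := exists_dilation_sum_le hGirv hHirv k (w := fun l => v (k - l))
    (fun l => by linarith [hv1 (k - l)]) hm0 hε0
  have hupper := hQ.eventually_tail_le_jumpBound hA hA0 hG hGirv hH hp0 hX k (β := 0) le_rfl
    hρ0 hρ1 (half_pos hc)
  have hlim : ∀ᶠ I : ℕ in atTop, ∀ j ∈ Finset.range k,
      v (j + 1) - ε / 2 < ∑ i ∈ Finset.range I, P.real {ω | i ≤ Q.X (j + 1) ω} :=
    (Finset.eventually_all _).2 fun j _ => (tendsto_sum_measureReal_le (hXm (j + 1))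
      (hX (j + 1))).eventually (lt_mem_nhds (show v (j + 1) - ε / 2 < v (j + 1) by linarith))
  obtain ⟨I, hI⟩ := hlim.exists
  -- The loss `δ` is incurred once for each of the `I` services of a stage, so that the total is at
  -- most `ε / 2`.
  set δ := ε / (2 * (I + 1)) with hδ
  have hδ0 : 0 < δ := by positivity
  have hδI : I * δ ≤ ε / 2 := by
    rw [hδ, show (I : ℝ) * (ε / (2 * (I + 1))) = ε / 2 * (I / (I + 1)) by field_simp]
    refine mul_le_of_le_one_right (by linarith) ?_
    rw [div_le_one (by positivity)]
    linarith
  have hδε : δ ≤ ε := div_le_self hε0.le (by linarith [(Nat.cast_nonneg I : (0 : ℝ) ≤ I)])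
  have hlower := hQ.eventually_le_tail hA hA0 hG hH hp0.le hr k I
    (one_lt_inv₀ hρ0 |>.2 hρ1) hδ0
  have hreg' := (tendsto_id.const_mul_atTop (inv_pos.2 hρ0)).eventually hreg
  filter_upwards [hupper, hlower, hreg, hreg'] with x hx1 hx2 hx3 hx4
  simp only [id, mul_inv_cancel_left₀ hρ0.ne'] at hx4
  have hup : P.real {ω | x < Q.T (k + 1) ω} ≤ (1 + c) * R x := by
    rw [jumpBound_eq_sum] at hx1
    simp only [rate_mul_iterate_eq_meanQueue hr, zero_mul, add_zero] at hx1
    have h1 : P.real {ω | x < Q.T (k + 1) ω} ≤ (1 + ε) * R x + c / 2 * tail G x :=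
      hx1.trans (add_le_add hx3 le_rfl)
    have h2 : c / 2 * tail G x ≤ c / 2 * R x := by gcongr; exact hGR x
    have h3 : ε * R x ≤ c / 2 * R x := mul_le_mul_of_nonneg_right hεc (hR0 x)
    linarith
  have hlow : (1 - c) * R x ≤ P.real {ω | x < Q.T (k + 1) ω} := by
    have h1 : (1 - ε) * R (ρ⁻¹ * x) ≤ P.real {ω | x < Q.T (k + 1) ω} := by
      refine le_trans ?_ hx2
      simp only [hR]
      -- Passes from the number `l` of stages after the jump to the stage index `j = k - 1 - l`.
      rw [mul_add, ← Finset.sum_range_reflect, Finset.mul_sum]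
      refine add_le_add (Finset.sum_le_sum fun j hj => ?_) ?_
      · have hjk := Finset.mem_range.1 hj
        rw [← Finset.sum_mul, ← mul_assoc, show k - (k - 1 - j) = j + 1 by omega,
          Finset.sum_sub_distrib, Finset.sum_const, Finset.card_range, nsmul_eq_mul]
        refine mul_le_mul_of_nonneg_right ?_ (tail_nonneg _ _)
        have h2 := hI j hj
        have h3 : ε * 1 ≤ ε * v (j + 1) := by gcongr; exact hv1 _
        linarith
      · exact mul_le_mul_of_nonneg_right (by linarith) (tail_nonneg _ _)
    have h2 : R x ≤ (1 + ε) * R (ρ⁻¹ * x) := hx4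
    have h3 : (1 - ε) * R x ≤ (1 + ε) * P.real {ω | x < Q.T (k + 1) ω} := by
      have hε1 : 0 ≤ 1 - ε := by linarith [min_le_right (c / 2) (1 / 2 : ℝ)]
      calc (1 - ε) * R x ≤ (1 - ε) * ((1 + ε) * R (ρ⁻¹ * x)) := by gcongr
        _ = (1 + ε) * ((1 - ε) * R (ρ⁻¹ * x)) := by ring
        _ ≤ _ := by gcongr
    have h4 : (1 + ε) * ((1 - c) * R x) ≤ (1 - ε) * R x := by
      rw [← mul_assoc]
      refine mul_le_mul_of_nonneg_right ?_ (hR0 x)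
      nlinarith
    exact le_of_mul_le_mul_left (h4.trans h3) (by linarith)
  rw [Pi.sub_apply, Real.norm_of_nonneg (hR0 x), Real.norm_eq_abs, abs_le]
  constructor <;> linarith

end FeedbackInput

theorem mainTheorem8 {Ω : Type*} [MeasurableSpace Ω] (P : Measure Ω) [IsProbabilityMeasure P]
    (A G H : Measure ℝ) (p : ℝ) (Q : FeedbackInput Ω)
    (hQ : Q.IsGIGI1 P A G H p)
    (hp0 : 0 < p) (hp1 : p < 1)
    (hA : IsNonnegLawWithMean A) (hA0 : 0 < mean A)
    (hG : IsNonnegLawWithMean G)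
    (hstable : (1 / mean A) * mean G / (1 - p) < 1)
    (hGirv : IsIRV G)
    (hH : IsNonnegLawWithMean H) (hHirv : IsIRV H)
    (hratio : ∃ c : ℝ≥0∞,
      Tendsto (fun x : ℝ => H (Set.Ioi x) / G (Set.Ioi x)) atTop (𝓝 c))
    (hX : ∀ k : ℕ, 1 ≤ k → Integrable (fun ω => (Q.X (k - 1) ω : ℝ)) P) :
    ∀ k : ℕ, 1 ≤ k →
      (fun x : ℝ => P.real {ω | x < Q.T k ω}) ~[atTop]
      (fun x : ℝ =>
        ∑ ℓ ∈ Finset.range (k - 1),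
          (∫ ω, (1 + (Q.X (k - ℓ - 1) ω : ℝ)) ∂P) *
            G.real {s | x < (1 + meanQueue (1 / mean A) (mean G) p ℓ) * s}
        + H.real {s | x < (1 + meanQueue (1 / mean A) (mean G) p (k - 1)) * s}) := by
  intro k hk
  have h1 : 0 < 1 - p := by linarith
  -- Stability means `r < 1`.
  have hr : p + 1 / mean A * mean G ≠ 1 := by
    rw [div_lt_one h1] at hstable
    linarith
  have hX' : ∀ k, Integrable (fun ω => (Q.X k ω : ℝ)) P := fun k => hX (k + 1) (by omega)
  have hm : ∀ l, 0 < 1 + meanQueue (1 / mean A) (mean G) p l := fun l => by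
    have := meanQueue_nonneg (by positivity : 0 ≤ 1 / mean A) hG.mean_nonneg hp0.le hr l
    linarith
  obtain ⟨k, rfl⟩ := Nat.exists_eq_add_of_le' hk
  have hsub : ∀ l, k + 1 - l - 1 = k - l := fun l => by omega
  simp only [real_lt_mul_eq_tail _ (hm _), Nat.add_sub_cancel, hsub]
  exact hQ.isEquivalent_tail hp0 hA hA0 hG hr hGirv hH hHirv hX' k
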